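/- Consider $\min_{x\in\mathbb R^d} g(x)-h(x)+r(x)$, where $g,h:\mathbb R^d\to\mathbb R$ are convex, $g$ is $L$-smooth ($L>0$), $h$ is differentiable with $\|\nabla h(x)-\nabla h(y)\|\le H\|x-y\|^\nu$ for all $x,y$ and some $\nu\in(0,1]$, and $r:\mathbb R^d\to\mathbb R\cup\{\infty\}$ is proper and lower semicontinuous (possibly non-convex and non-smooth). For $\mu>0$ let $\mathrm{prox}_{\mu r}(x)$ denote a (measurably selected) minimizer of $y\mapsto\frac1{2\mu}\|y-x\|^2+r(y)$, let $r_\mu(x)$ be the minimal value, and write $r_\mu(x)=\frac1{2\mu}\|x\|^2-R_\mu(x)$ with $R_\mu$ convex; $\frac1\mu\mathrm{prox}_{\mu r}(x)$ is a subgradient of $R_\mu$ at $x$. Let $F_\mu=g-h+r_\mu$. The initial point $x_1$ is such that, for some $\Delta$ and all sufficiently small $\mu>0$, $F_\mu(x_1)-\inf F_\mu\le\Delta$. Let $\hat\partial r$ be the Fréchet subdifferential. Consider the following conditions on $r$: (i) $r$ is (finite and) Lipschitz continuous; (ii) $r$ is finite-valued and bounded below; (iii) $g-h+r_\mu$ is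 level bounded for some $\mu\in(0,1)$, and $r$ is finite on a nonempty compact set and bounded below. The stagewise algorithm (SSDC), with a constant $\gamma>0$, applied to the DC problem $\min_x g(x)+\frac1{2\mu}\|x\|^2-(h(x)+R_\mu(x))$, computes for $k=1,\dots,K$ a point $x_{k+1}$ by running a stochastic method, started at $x_k$, on $$F_k(x)=g(x)+\tfrac1{2\mu}\|x\|^2-\big(\nabla h(x_k)+\tfrac1\mu\mathrm{prox}_{\mu r}(x_k)\big)^\top(x-x_k)+\tfrac\gamma2\|x-x_k\|^2 .$$ It returns $x_\tau$, where $\tau\in\{1,\dots,K\}$ is drawn independently of the run with $\Pr(\tau=k)=k^\alpha/\sum_{j=1}^Kj^\alpha$, for a fixed $\alpha\ge1$. Put $w_\tau=\mathrm{prox}_{\mu r}(x_\tau)$. The stochastic method is one of the following. * SPG, with $\gamma\ge 3L$. Let $v_g(x;\xi)$ and $v_h(x;\varsigma)$ be unbiased stochastic gradients of $g$ and $h$ ($\xi,\varsigma$ independent) such that, for some $G>0$, $\mathrm E\|v_g(x;\xi)-v_h(x;\varsigma)-\nabla g(x)+\nabla h(x)\|^2\le G^2$ for all $x$. With fresh samples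 at each step, stage $k$ sets $y_1=x_k$ and, for $t=1,\dots,T_k$, $$y_{t+1}=\arg\min_y\; y^\top\big(v_g(y_t;\xi_t)-v_h(x_k;\varsigma_t)-\tfrac1\mu\mathrm{prox}_{\mu r}(x_k)\big)+\tfrac1{2\mu}\|y\|^2+\tfrac\gamma2\|y-x_k\|^2+\tfrac1{2\eta_t}\|y-y_t\|^2,\qquad \eta_t=\tfrac{3}{\gamma(t+1)},$$ and returns $x_{k+1}=\sum_{t=2}^{T_k+1}t\,y_t\big/\sum_{t=2}^{T_k+1}t$, where $T_k\ge 3Lk/\gamma+3$. * SVRG, with any $\gamma>0$, when $g=\frac1n\sum_{i=1}^n g_i$ with every $g_i$ $L$-smooth. Stage $k$ starts from $\bar y^{(0)}=x_k$ and performs $S_k=\lceil\log_2k\rceil$ epochs of $T_k\ge\max(2,200L/\gamma)$ steps. Epoch $s$ starts at $y_0=\bar y^{(s-1)}$, draws $i_t\in\{1,\dots,n\}$ uniformly and independently, and sets, for $t=1,\dots,T_k$, $$y_t=\arg\min_y\;\langle\nabla_t,y-y_{t-1}\rangle+\tfrac1{2\eta}\|y-y_{t-1}\|^2+\tfrac1{2\mu}\|y\|^2+\tfrac\gamma2\|y-x_k\|^2,\qquad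 \eta=\tfrac{0.05}{L},$$ $$\nabla_t=\nabla g_{i_t}(y_{t-1})-\nabla g_{i_t}(\bar y^{(s-1)})+\nabla g(\bar y^{(s-1)})-\nabla h(x_k)-\tfrac1\mu\mathrm{prox}_{\mu r}(x_k);$$ then $\bar y^{(s)}=\frac1{T_k}\sum_{t=1}^{T_k}y_t$, and $x_{k+1}=\bar y^{(S_k)}$. Then for all constants $0<a\le b$ there are $C,\varepsilon_0>0$ such that for every $\varepsilon\in(0,\varepsilon_0]$ $$\mathrm E\,\|x_\tau-w_\tau\|\le C\varepsilon,\qquad \mathrm E\big[\mathrm{dist}\big(\nabla h(w_\tau),\,\nabla g(w_\tau)+\hat\partial r(w_\tau)\big)\big]\le C\varepsilon^{\nu}$$ in each of the following cases (the second expectation is an upper expectation, so that no measurability question arises): (a) SPG, under (i), with $\mu=\varepsilon$ and any number of stages $K\in[a\varepsilon^{-2(1+\nu)},\,b\varepsilon^{-2(1+\nu)}]$; (b) SPG, under (ii), with $\mu=\varepsilon^2$ and any $K\in[a\varepsilon^{-2(2+\nu)},\,b\varepsilon^{-2(2+\nu)}]$; (c) SVRG, either under (i) with $\mu$ and $K$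 as in (a), or under (ii) or (iii) with $\mu$ and $K$ as in (b). The constants $C,\varepsilon_0$ do not depend on $\varepsilon$, $K$, the $T_k$, the selection of $\mathrm{prox}_{\mu r}$ or the probability space. -/

import Mathlib

open MeasureTheory ProbabilityTheory
open scoped ENNReal

universe u

/-! ### Smoothness, regularizers, proximal mapping, Moreau envelope, subdifferential -/

/-- `ℝᵈ` with the Euclidean norm. -/
abbrev Vec (d : ℕ) : Type := EuclideanSpace ℝ (Fin d)

/-- `φ` is differentiable and its gradient is `(L, ν)`-Hölder continuous. -/
def HolderGradient {d : ℕ} (L ν : ℝ) (φ : Vec d → ℝ) : Prop :=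
  Differentiable ℝ φ ∧ ∀ x y, ‖gradient φ x - gradient φ y‖ ≤ L * ‖x - y‖ ^ ν

/-- `φ` is `L`-smooth: differentiable with an `L`-Lipschitz gradient. -/
def LSmooth {d : ℕ} (L : ℝ) (φ : Vec d → ℝ) : Prop :=
  Differentiable ℝ φ ∧ ∀ x y, ‖gradient φ x - gradient φ y‖ ≤ L * ‖x - y‖

/-- A proper lower-semicontinuous function with values in `ℝ ∪ {∞}`. -/
def ProperLsc {d : ℕ} (r : Vec d → EReal) : Prop :=
  (∀ x, r x ≠ ⊥) ∧ (∃ x, r x ≠ ⊤) ∧ LowerSemicontinuous r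

/-- The function `y ↦ ‖y - x‖² / (2μ) + r(y)`. -/
noncomputable def proxObjective {d : ℕ} (r : Vec d → EReal) (μ : ℝ) (x y : Vec d) : EReal :=
  ((‖y - x‖ ^ 2 / (2 * μ) : ℝ) : EReal) + r y

/-- The (possibly multi-valued) proximal mapping `prox_{μ r}(x)`. -/
def proxSet {d : ℕ} (r : Vec d → EReal) (μ : ℝ) (x : Vec d) : Set (Vec d) :=
  {y | ∀ z, proxObjective r μ x y ≤ proxObjective r μ x z}

/-- The Moreau envelope `r_μ`. -/
noncomputable def moreau {d : ℕ} (r : Vec d → EReal) (μ : ℝ) (x : Vec d) : EReal :=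
  ⨅ y, proxObjective r μ x y

/-- The smoothed objective `F_μ = g - h + r_μ`. -/
noncomputable def smoothedObjective {d : ℕ} (g h : Vec d → ℝ) (r : Vec d → EReal) (μ : ℝ)
    (x : Vec d) : EReal :=
  ((g x - h x : ℝ) : EReal) + moreau r μ x

/-- The Fréchet subdifferential of `r` at `x` (empty outside the domain of `r`). The last clause
says that the lower limit of `(r y - r x - ⟨v, y - x⟩) / ‖y - x‖` as `y → x` is nonnegative. -/
def frechetSubdiff {d : ℕ} (r : Vec d → EReal) (x : Vec d) : Set (Vec d) :=
  {v | r x ≠ ⊤ ∧ ∀ δ : ℝ, 0 < δ → ∀ᶠ y in nhds x,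
    r x + ((inner ℝ v (y - x) - δ * ‖y - x‖ : ℝ) : EReal) ≤ r y}

/-- The distance from `∇h(w)` to the set `∇g(w) + ∂̂r(w)` (it is `∞` if the set is empty). -/
noncomputable def criticality {d : ℕ} (g h : Vec d → ℝ) (r : Vec d → EReal) (w : Vec d) : ℝ≥0∞ :=
  Metric.infEDist (gradient h w) ((fun v => gradient g w + v) '' frechetSubdiff r w)

/-- Condition (i): `r` is (finite-valued and) Lipschitz continuous. -/
def LipschitzReg {d : ℕ} (r : Vec d → EReal) : Prop :=
  ∃ (ρ : Vec d → ℝ) (M : NNReal), LipschitzWith M ρ ∧ ∀ x, r x = ((ρ x : ℝ) : EReal)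

/-- Condition (ii): `r` is lower bounded and finite-valued. -/
def FiniteReg {d : ℕ} (r : Vec d → EReal) : Prop :=
  (∃ m : ℝ, ∀ x, (m : EReal) ≤ r x) ∧ ∀ x, r x ≠ ⊤

/-- Condition (iii): `g - h + r_μ` is level bounded for some `μ < 1`, and `r` is finite-valued on a
(nonempty) compact set and lower bounded. -/
def LevelBoundedReg {d : ℕ} (g h : Vec d → ℝ) (r : Vec d → EReal) : Prop :=
  (∃ μ : ℝ, 0 < μ ∧ μ < 1 ∧
    ∀ c : ℝ, Bornology.IsBounded {x | smoothedObjective g h r μ x ≤ (c : EReal)}) ∧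
  (∃ S : Set (Vec d), IsCompact S ∧ S.Nonempty ∧ ∀ x ∈ S, r x ≠ ⊤) ∧
  ∃ m : ℝ, ∀ x, (m : EReal) ≤ r x

/-- The initial gap `F_μ(x₁) - inf F_μ` is at most some `Δ`, uniformly over all small `μ`. -/
def BoundedInitialGap {d : ℕ} (g h : Vec d → ℝ) (r : Vec d → EReal) (x₁ : Vec d) : Prop :=
  ∃ μ₀ Δ : ℝ, 0 < μ₀ ∧ ∀ μ : ℝ, 0 < μ → μ ≤ μ₀ → ∀ x,
    smoothedObjective g h r μ x₁ ≤ smoothedObjective g h r μ x + (Δ : EReal)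

/-! ### The algorithms -/

/-- The minimizer of `φ` (every use below is for a strongly convex `φ`). -/
noncomputable def argmin {d : ℕ} (φ : Vec d → ℝ) : Vec d :=
  Classical.epsilon fun x => ∀ y, φ x ≤ φ y

/-- The sequence `x₁ = a`, `x_{n+1} = step n x_n` for `n ≥ 1` (index `0` is a filler). -/
def iterFromOne {X : Type*} (step : ℕ → X → X) (a : X) : ℕ → X
  | 0 => a
  | n + 1 => if n = 0 then a else step n (iterFromOne step a n)

/-- The iterates `x_t`, `t ≥ 1`, of the stochastic proximal gradient method (option 1, step sizes
`η_t = 3 / (γ (t + 1))`), where `v t x` is the stochastic gradient at `x` used in step `t`. -/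
noncomputable def spgIter {d : ℕ} (v : ℕ → Vec d → Vec d) (q : Vec d → ℝ) (γ : ℝ) (x₁ : Vec d) :
    ℕ → Vec d :=
  iterFromOne (fun t x => argmin fun y =>
    inner ℝ y (v t x) + q y + γ / 2 * ‖y - x₁‖ ^ 2
      + 1 / (2 * (3 / (γ * ((t : ℝ) + 1)))) * ‖y - x‖ ^ 2) x₁

/-- The output `(∑_{t=2}^{T+1} t x_t) / (∑_{t=2}^{T+1} t)` of `T` steps of that method. -/
noncomputable def spg {d : ℕ} (v : ℕ → Vec d → Vec d) (q : Vec d → ℝ) (γ : ℝ) (x₁ : Vec d)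
    (T : ℕ) : Vec d :=
  (∑ t ∈ Finset.Icc 2 (T + 1), (t : ℝ))⁻¹ •
    ∑ t ∈ Finset.Icc 2 (T + 1), (t : ℝ) • spgIter v q γ x₁ t

/-- The inner iterates `x_0, x_1, …` of one SVRG epoch started at the reference point `xbar`:
`x_t` minimizes `⟨∇_t, y - x_{t-1}⟩ + ‖y - x_{t-1}‖² / (2η) + q(y) + (γ/2) ‖y - x₁‖²` with
`∇_t = ∇g_{i_t}(x_{t-1}) - ∇g_{i_t}(xbar) + ∇g(xbar) - c`, where `c` is the subgradient at `x₁` of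
the subtracted convex function. -/
noncomputable def svrgInner {d n : ℕ} (gs : Fin n → Vec d → ℝ) (g : Vec d → ℝ) (c : Vec d)
    (q : Vec d → ℝ) (γ η : ℝ) (x₁ xbar : Vec d) (i : ℕ → Fin n) : ℕ → Vec d
  | 0 => xbar
  | t + 1 =>
    let x := svrgInner gs g c q γ η x₁ xbar i t
    argmin fun y =>
      inner ℝ (gradient (gs (i (t + 1))) x - gradient (gs (i (t + 1))) xbar
          + (gradient g xbar - c)) (y - x)
        + 1 / (2 * η) * ‖y - x‖ ^ 2 + q y + γ / 2 * ‖y - x₁‖ ^ 2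

/-- The reference points `xbar^{(s)}` of SVRG with `T` inner steps per epoch; `i s t` is the index
drawn in step `t` of epoch `s`. The output of `S` epochs is the value at `S`. -/
noncomputable def svrg {d n : ℕ} (gs : Fin n → Vec d → ℝ) (g : Vec d → ℝ) (c : Vec d)
    (q : Vec d → ℝ) (γ η : ℝ) (x₁ : Vec d) (T : ℕ) (i : ℕ → ℕ → Fin n) : ℕ → Vec d
  | 0 => x₁
  | s + 1 => (T : ℝ)⁻¹ • ∑ t ∈ Finset.Icc 1 T,
      svrgInner gs g c q γ η x₁ (svrg gs g c q γ η x₁ T i s) (i (s + 1)) t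

/-- The quadratic `‖y‖² / (2μ)`, the convex part of the DC decomposition
`r_μ(y) = ‖y‖² / (2μ) - R_μ(y)` of the Moreau envelope. -/
noncomputable def quadReg {d : ℕ} (μ : ℝ) (y : Vec d) : ℝ := ‖y‖ ^ 2 / (2 * μ)

/-- The stages `x_k`, `k ≥ 1`, of SSDC-SPG for the DC problem
`min g(x) + ‖x‖² / (2μ) - (h(x) + R_μ(x))`. The function `p` selects points of `prox_{μ r}`, so
that `p(x)/μ` is a subgradient of `R_μ` at `x`. Step `t` of stage `k` uses the fresh sample
`s (k, t)`. -/
noncomputable def ssdcSPG {d : ℕ} {Ξ Z : Type*} (vg : Vec d → Ξ → Vec d) (vh : Vec d → Z → Vec d)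
    (p : Vec d → Vec d) (μ γ : ℝ) (T : ℕ → ℕ) (x₁ : Vec d) (s : ℕ × ℕ → Ξ × Z) : ℕ → Vec d :=
  iterFromOne (fun k x =>
    spg (fun t y => vg y (s (k, t)).1 - (vh x (s (k, t)).2 + (1 / μ) • p x)) (quadReg μ) γ x (T k))
    x₁

/-- The stages `x_k`, `k ≥ 1`, of SSDC-SVRG for the same DC problem; `i (k, s, t)` is the index
drawn in inner step `t` of epoch `s` of stage `k`, which has `S k` epochs of `T k` steps. -/
noncomputable def ssdcSVRG {d n : ℕ} (gs : Fin n → Vec d → ℝ) (g h : Vec d → ℝ)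
    (p : Vec d → Vec d) (μ γ η : ℝ) (T S : ℕ → ℕ) (x₁ : Vec d) (i : ℕ × ℕ × ℕ → Fin n) :
    ℕ → Vec d :=
  iterFromOne (fun k x =>
    svrg gs g (gradient h x + (1 / μ) • p x) (quadReg μ) γ η x (T k) (fun s t => i (k, s, t)) (S k))
    x₁

/-! ### Probability -/

/-- `v x ξ`, `ξ ∼ Q`, is an unbiased stochastic gradient of `φ` at every `x`. For
`φ(x) = E[φ(x; ξ)]` one takes `v x ξ = ∇φ(x; ξ)`. -/
structure IsStochasticGradient {d : ℕ} {Ξ : Type*} [MeasurableSpace Ξ] (φ : Vec d → ℝ)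
    (Q : Measure Ξ) (v : Vec d → Ξ → Vec d) : Prop where
  measurable : Measurable (Function.uncurry v)
  integrable : ∀ x, Integrable (v x) Q
  mean : ∀ x, ∫ ξ, v x ξ ∂Q = gradient φ x

/-- The stochastic gradient `v_g(x; ξ) - v_h(x; ς)`, with `ξ` and `ς` independent, has variance at
most `G²` at every `x`. -/
def BoundedVariance {d : ℕ} {Ξ Z : Type*} [MeasurableSpace Ξ] [MeasurableSpace Z]
    (g h : Vec d → ℝ) (Q : Measure Ξ) (Q' : Measure Z) (vg : Vec d → Ξ → Vec d)
    (vh : Vec d → Z → Vec d) (G : ℝ) : Prop :=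
  ∀ x, ∫⁻ u, ‖(vg x u.1 - vh x u.2) - (gradient g x - gradient h x)‖ₑ ^ 2 ∂(Q.prod Q')
    ≤ ENNReal.ofReal (G ^ 2)

/-- `τ` takes the value `k ∈ {1, …, K}` with probability `k^α / ∑_{j=1}^K j^α`. -/
def IsStageIndex {Ω : Type*} [MeasurableSpace Ω] (P : Measure Ω) (K : ℕ) (α : ℝ) (τ : Ω → ℕ) :
    Prop :=
  Measurable τ ∧ ∀ k ∈ Finset.Icc 1 K,
    P {ω | τ ω = k} = ENNReal.ofReal ((k : ℝ) ^ α / ∑ j ∈ Finset.Icc 1 K, (j : ℝ) ^ α)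

/-- The upper expectation: the infimum of the expectations of the measurable majorants of `f`. It
is the usual expectation for every measurable `f ≥ 0`. -/
noncomputable def upperExp {Ω : Type*} [MeasurableSpace Ω] (P : Measure Ω) (f : Ω → ℝ≥0∞) : ℝ≥0∞ :=
  ⨅ φ ∈ {φ : Ω → ℝ≥0∞ | Measurable φ ∧ f ≤ φ}, ∫⁻ ω, φ ω ∂P

theorem upperExp_eq_lintegral {Ω : Type*} [MeasurableSpace Ω] (P : Measure Ω) {f : Ω → ℝ≥0∞}
    (hf : Measurable f) : upperExp P f = ∫⁻ ω, f ω ∂P :=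
  le_antisymm (iInf₂_le f ⟨hf, le_refl f⟩) (le_iInf₂ fun _ hφ => lintegral_mono hφ.2)

/-! ### The convergence claims -/

/-- SSDC-SPG with `μ = ε^m`, inner iteration numbers `T_k ≥ 3Lk/γ + 3`, and any number `K` of
stages between `a ε^{-e}` and `b ε^{-e}` returns `x_τ` such that `w_τ = prox_{μ r}(x_τ)` satisfies
`E‖x_τ - w_τ‖ ≤ C ε` and `E dist(∇h(w_τ), ∇g(w_τ) + ∂̂r(w_τ)) ≤ C ε^ν` for all small `ε`. -/
def SPGConvergence {d : ℕ} {Ξ Z : Type u} [MeasurableSpace Ξ] [MeasurableSpace Z]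
    (g h : Vec d → ℝ) (r : Vec d → EReal) (Q : Measure Ξ) (Q' : Measure Z)
    (vg : Vec d → Ξ → Vec d) (vh : Vec d → Z → Vec d) (L ν γ α : ℝ) (x₁ : Vec d) (a b : ℝ)
    (m : ℕ) (e : ℝ) : Prop :=
  ∃ C ε₀ : ℝ, 0 < C ∧ 0 < ε₀ ∧
    ∀ (Ω : Type u) [MeasurableSpace Ω] (P : Measure Ω) [IsProbabilityMeasure P]
      (s : ℕ × ℕ → Ω → Ξ × Z) (ε : ℝ) (K : ℕ) (T : ℕ → ℕ) (p : Vec d → Vec d) (τ : Ω → ℕ),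
      -- the samples are independent, each with law `Q ⊗ Q'`
      (∀ j, Measurable (s j)) → iIndepFun s P → (∀ j, P.map (s j) = Q.prod Q') →
      0 < ε → ε ≤ ε₀ → a * ε ^ (-e) ≤ (K : ℝ) → (K : ℝ) ≤ b * ε ^ (-e) →
      (∀ k : ℕ, 1 ≤ k → 3 * L * (k : ℝ) / γ + 3 ≤ (T k : ℝ)) →
      -- `p` is a measurable selection of the proximal mapping
      Measurable p → (∀ x, p x ∈ proxSet r (ε ^ m) x) →
      -- `τ` is sampled independently of the run
      IsStageIndex P K α τ → IndepFun τ (fun ω j => s j ω) P →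
      ∫⁻ ω, edist (ssdcSPG vg vh p (ε ^ m) γ T x₁ (fun j => s j ω) (τ ω))
          (p (ssdcSPG vg vh p (ε ^ m) γ T x₁ (fun j => s j ω) (τ ω))) ∂P
        ≤ ENNReal.ofReal (C * ε) ∧
      upperExp P (fun ω => criticality g h r
          (p (ssdcSPG vg vh p (ε ^ m) γ T x₁ (fun j => s j ω) (τ ω))))
        ≤ ENNReal.ofReal (C * ε ^ ν)

/-- The same claim for SSDC-SVRG with step size `η = 0.05 / L`, `T_k ≥ max(2, 200L/γ)` inner steps
and `S_k = ⌈log₂ k⌉` epochs in stage `k`. -/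
def SVRGConvergence {d n : ℕ} (gs : Fin n → Vec d → ℝ) (g h : Vec d → ℝ) (r : Vec d → EReal)
    (L ν γ α : ℝ) (x₁ : Vec d) (a b : ℝ) (m : ℕ) (e : ℝ) : Prop :=
  ∃ C ε₀ : ℝ, 0 < C ∧ 0 < ε₀ ∧
    ∀ (Ω : Type u) [MeasurableSpace Ω] (P : Measure Ω) [IsProbabilityMeasure P]
      (i : ℕ × ℕ × ℕ → Ω → Fin n) (ε : ℝ) (K : ℕ) (T : ℕ → ℕ) (p : Vec d → Vec d) (τ : Ω → ℕ),
      -- the indices are independent and uniform on the `n` components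
      (∀ j, Measurable (i j)) → iIndepFun i P → (∀ j l, P {ω | i j ω = l} = (n : ℝ≥0∞)⁻¹) →
      0 < ε → ε ≤ ε₀ → a * ε ^ (-e) ≤ (K : ℝ) → (K : ℝ) ≤ b * ε ^ (-e) →
      (∀ k : ℕ, 1 ≤ k → max 2 (200 * L / γ) ≤ (T k : ℝ)) →
      Measurable p → (∀ x, p x ∈ proxSet r (ε ^ m) x) →
      IsStageIndex P K α τ → IndepFun τ (fun ω j => i j ω) P →
      ∫⁻ ω, edist
          (ssdcSVRG gs g h p (ε ^ m) γ (0.05 / L) T (Nat.clog 2) x₁ (fun j => i j ω) (τ ω))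
          (p (ssdcSVRG gs g h p (ε ^ m) γ (0.05 / L) T (Nat.clog 2) x₁ (fun j => i j ω) (τ ω))) ∂P
        ≤ ENNReal.ofReal (C * ε) ∧
      upperExp P (fun ω => criticality g h r
          (p (ssdcSVRG gs g h p (ε ^ m) γ (0.05 / L) T (Nat.clog 2) x₁ (fun j => i j ω) (τ ω))))
        ≤ ENNReal.ofReal (C * ε ^ ν)

/-! ### Gradients of convex and of smooth functions -/

/-! Write σ = 1/μ + γ and let z(x) be the exact minimizer of the σ-strongly convex problem of a
stage started at x.

Descent. Convexity of g and h and the majorization of r_μ by its proximal points give F_μ(y) +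
(σ/2)‖x - z(x)‖² ≤ F_μ(x) + σ‖y - z(x)‖² (`envObj_add_le`). If each stage satisfies E‖x_{k+1} -
z(x_k)‖² ≤ (1/4) E‖x_k - z(x_k)‖² + B/(σ²k), telescoping bounds every E F_μ(x_k) - inf F_μ, and also
the sum of σ E‖x_k - z(x_k)‖² over k ≤ K, by O(1 + (log K)/σ) (`lintegral_descent`). This is O(1),
because 1/σ ≤ ε and K is polynomial in 1/ε. The law of τ gives each stage mass at most 2^α/K, so σ
E‖x_τ - z(x_τ)‖² = O(1/K).

Criticality. With w = prox(x), the vector (x - w)/μ is a Fréchet subgradient of r at w, and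
stationarity of z(x) bounds the distance by |H|‖x - w‖^ν + L‖x - w‖ + (L + σ)‖x - z(x)‖
(`criticality_le`). For μ = ε^m the last term is O(ε^ν) in mean as soon as K is at least of order
ε^{-(m + 2ν)}.

Proximal displacement (`EnvBounds`). For Lipschitz r, ‖x - w‖ = O(μ), so μ = ε suffices. For r
bounded below, comparing the envelopes with parameters μ and 2μ bounds ‖x - w‖² by 4μ times the gap
of F_μ at x plus a constant, so μ = ε² suffices.

Stages. For small μ, σ dominates L. In SVRG this alone brings every inner iterate within half the
distance of the epoch's reference point to z, for every draw of the indices (`norm_svrg_sub_le`). In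
SPG the weighted sum of the errors is expressed through a sum of centered noises with orthogonal
increments (`spg_sum_identity`), whose average has variance O(1/(σ²T_k)) (`spg_stage`); T_k ≥ 3Lk/γ
turns this into B/(σ²k). -/

theorem ConvexOn.add_inner_gradient_le {d : ℕ} {g : Vec d → ℝ} (hg : ConvexOn ℝ Set.univ g)
    (hd : Differentiable ℝ g) (x y : Vec d) :
    g x + inner ℝ (gradient g x) (y - x) ≤ g y := by
  have hc : ConvexOn ℝ Set.univ (g ∘ AffineMap.lineMap x y : ℝ → ℝ) := by
    simpa using hg.comp_affineMap (AffineMap.lineMap x y : ℝ →ᵃ[ℝ] Vec d)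
  have hder : HasDerivAt (g ∘ AffineMap.lineMap x y : ℝ → ℝ) (fderiv ℝ g x (y - x)) 0 := by
    have h1 : HasDerivAt (AffineMap.lineMap x y : ℝ → Vec d) (y - x) 0 := AffineMap.hasDerivAt_lineMap
    have h2 : HasFDerivAt g (fderiv ℝ g x) ((AffineMap.lineMap x y : ℝ → Vec d) 0) := by
      simpa using (hd x).hasFDerivAt
    exact h2.comp_hasDerivAt 0 h1
  have := hc.le_slope_of_hasDerivAt (Set.mem_univ 0) (Set.mem_univ 1) zero_lt_one hder
  rw [inner_gradient_left]
  simp only [slope_def_field, Function.comp_apply, AffineMap.lineMap_apply_one,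
    AffineMap.lineMap_apply_zero, sub_zero, div_one] at this
  linarith

/-- The constant L instead of the sharp L/2 comes from convexity at `y` and Cauchy–Schwarz, without
integrating along a segment; the loss is harmless because σ dominates L. -/
theorem ConvexOn.le_add_inner_gradient_add_sq {d : ℕ} {g : Vec d → ℝ} {L : ℝ}
    (hg : ConvexOn ℝ Set.univ g) (hL : LSmooth L g) (x y : Vec d) :
    g y ≤ g x + inner ℝ (gradient g x) (y - x) + L * ‖y - x‖ ^ 2 := by
  have h1 := hg.add_inner_gradient_le hL.1 y x
  have h2 : inner ℝ (gradient g y - gradient g x) (y - x) ≤ L * ‖y - x‖ ^ 2 := by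
    calc _ ≤ ‖gradient g y - gradient g x‖ * ‖y - x‖ := real_inner_le_norm _ _
      _ ≤ L * ‖y - x‖ * ‖y - x‖ := by gcongr; exact hL.2 y x
      _ = _ := by ring
  have h3 : inner ℝ (gradient g y) (x - y) = - inner ℝ (gradient g y) (y - x) := by
    rw [← inner_neg_right, neg_sub]
  rw [inner_sub_left] at h2
  linarith

theorem measurable_gradient {d : ℕ} (h : Vec d → ℝ) : Measurable (gradient h) :=
  (InnerProductSpace.toDual ℝ (Vec d)).symm.continuous.measurable.comp (measurable_fderiv ℝ h)

/-! ### Explicit form of the proximal steps -/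

theorem argmin_eq_of_forall_eq_add {d : ℕ} {φ : Vec d → ℝ} {y₀ : Vec d} {c : ℝ} (hc : 0 < c)
    (h : ∀ y, φ y = φ y₀ + c * ‖y - y₀‖ ^ 2) : argmin φ = y₀ := by
  have hex : ∃ x, ∀ y, φ x ≤ φ y := ⟨y₀, fun y => by rw [h y]; nlinarith [sq_nonneg ‖y - y₀‖]⟩
  have hs : ∀ y, φ (argmin φ) ≤ φ y := Classical.epsilon_spec hex
  have h1 := hs y₀
  rw [h (argmin φ)] at h1
  have h2 : ‖argmin φ - y₀‖ ^ 2 ≤ 0 := by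
    by_contra hlt
    push Not at hlt
    have := mul_pos hc hlt
    linarith
  have h3 : ‖argmin φ - y₀‖ = 0 := pow_eq_zero_iff (two_ne_zero) |>.1 (le_antisymm h2 (sq_nonneg _))
  exact sub_eq_zero.1 (norm_eq_zero.1 h3)

/-- Completing the square. Every proximal step of both methods has this form; `κ` absorbs terms
independent of `y`. -/
theorem argmin_proxStep {d : ℕ} {φ : Vec d → ℝ} {β μ γ κ : ℝ} (v x x₁ : Vec d)
    (hs : 0 < β + (1 / μ + γ))
    (hφ : ∀ y, φ y = inner ℝ y v + ‖y‖ ^ 2 / (2 * μ) + γ / 2 * ‖y - x₁‖ ^ 2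
      + β / 2 * ‖y - x‖ ^ 2 + κ) :
    argmin φ = (β + (1 / μ + γ))⁻¹ • (β • x + γ • x₁ - v) := by
  set s := β + (1 / μ + γ) with hsdef
  set y₀ := s⁻¹ • (β • x + γ • x₁ - v) with hy₀
  have hv : v = β • x + γ • x₁ - s • y₀ := by
    rw [hy₀, smul_smul, mul_inv_cancel₀ hs.ne', one_smul]; abel
  refine argmin_eq_of_forall_eq_add (half_pos hs) fun y => ?_
  obtain ⟨w, rfl⟩ : ∃ w, y = y₀ + w := ⟨y - y₀, by abel⟩
  rw [hφ, hφ, add_sub_cancel_left]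
  have e1 : y₀ + w - x₁ = (y₀ - x₁) + w := by abel
  have e2 : y₀ + w - x = (y₀ - x) + w := by abel
  rw [e1, e2, norm_add_sq_real, norm_add_sq_real, norm_add_sq_real, inner_add_left]
  have e3 : inner ℝ w v = β * inner ℝ x w + γ * inner ℝ x₁ w - s * inner ℝ y₀ w := by
    rw [hv, real_inner_comm, inner_sub_left, inner_add_left, inner_smul_left, inner_smul_left,
      inner_smul_left]
    simp
  rw [e3, inner_sub_left, inner_sub_left]
  simp only [hsdef, div_eq_mul_inv, mul_inv]
  ring

/-! ### The Moreau envelope through a selection of the proximal mapping -/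

/-- The value of the Moreau envelope, through a selection `p` of the proximal mapping. -/
noncomputable def moreauVal {d : ℕ} (r : Vec d → EReal) (μ : ℝ) (p : Vec d → Vec d) (x : Vec d) :
    ℝ :=
  ‖p x - x‖ ^ 2 / (2 * μ) + (r (p x)).toReal

/-- The real-valued smoothed objective. -/
noncomputable def envObj {d : ℕ} (g h : Vec d → ℝ) (r : Vec d → EReal) (μ : ℝ)
    (p : Vec d → Vec d) (x : Vec d) : ℝ :=
  g x - h x + moreauVal r μ p x

section Prox

variable {d : ℕ} {g h : Vec d → ℝ} {r : Vec d → EReal} {μ : ℝ} {p : Vec d → Vec d}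

theorem ne_top_of_mem_proxSet (hr : ProperLsc r) {x y : Vec d} (hy : y ∈ proxSet r μ x) :
    r y ≠ ⊤ := by
  obtain ⟨x₀, hx₀⟩ := hr.2.1
  intro htop
  have h1 := hy x₀
  unfold proxObjective at h1
  rw [htop, EReal.coe_add_top, top_le_iff] at h1
  lift r x₀ to ℝ using ⟨hx₀, hr.1 x₀⟩ with a
  exact EReal.coe_ne_top _ (by rw [← EReal.coe_add] at h1; exact h1)

theorem coe_toReal_of_mem_proxSet (hr : ProperLsc r) {x y : Vec d} (hy : y ∈ proxSet r μ x) :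
    ((r y).toReal : EReal) = r y :=
  EReal.coe_toReal (ne_top_of_mem_proxSet hr hy) (hr.1 y)

theorem proxObjective_eq_moreauVal (hr : ProperLsc r) (hp : ∀ x, p x ∈ proxSet r μ x) (x : Vec d) :
    proxObjective r μ x (p x) = (moreauVal r μ p x : EReal) := by
  unfold proxObjective moreauVal
  rw [EReal.coe_add, coe_toReal_of_mem_proxSet hr (hp x)]

theorem moreauVal_le_proxObjective (hr : ProperLsc r) (hp : ∀ x, p x ∈ proxSet r μ x)
    (x y : Vec d) : (moreauVal r μ p x : EReal) ≤ proxObjective r μ x y := by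
  rw [← proxObjective_eq_moreauVal hr hp]
  exact hp x y

/-- The proximal point of `x` is a competitor at `y`. The convexity of R_μ, with subgradient `p
x`/μ, enters in this form. -/
theorem moreauVal_le (hr : ProperLsc r) (hp : ∀ x, p x ∈ proxSet r μ x) (x y : Vec d) :
    moreauVal r μ p y ≤ ‖p x - y‖ ^ 2 / (2 * μ) + (r (p x)).toReal := by
  have h1 := moreauVal_le_proxObjective hr hp y (p x)
  unfold proxObjective at h1
  rw [← coe_toReal_of_mem_proxSet hr (hp x), ← EReal.coe_add] at h1
  exact EReal.coe_le_coe_iff.1 h1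

theorem moreau_eq_moreauVal (hr : ProperLsc r) (hp : ∀ x, p x ∈ proxSet r μ x) (x : Vec d) :
    moreau r μ x = (moreauVal r μ p x : EReal) :=
  le_antisymm ((iInf_le _ (p x)).trans (proxObjective_eq_moreauVal hr hp x).le)
    (le_iInf fun y => moreauVal_le_proxObjective hr hp x y)

theorem smoothedObjective_eq_envObj (hr : ProperLsc r) (hp : ∀ x, p x ∈ proxSet r μ x)
    (x : Vec d) : smoothedObjective g h r μ x = (envObj g h r μ p x : EReal) := by
  unfold smoothedObjective envObj
  rw [moreau_eq_moreauVal hr hp, ← EReal.coe_add]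

theorem measurable_envObj (hg : Measurable g) (hh : Measurable h) (hr : ProperLsc r)
    (hp : Measurable p) : Measurable (envObj g h r μ p) := by
  have h1 : Measurable fun x => (r (p x)).toReal :=
    measurable_ereal_toReal.comp (hr.2.2.measurable.comp hp)
  unfold envObj moreauVal
  exact (hg.sub hh).add ((((hp.sub measurable_id).norm.pow_const 2).div_const _).add h1)

/-- The scaled residual of a proximal point is a Fréchet subgradient. -/
theorem smul_sub_mem_frechetSubdiff (hr : ProperLsc r) (hμ : 0 < μ) {x w : Vec d}
    (hw : w ∈ proxSet r μ x) : (1 / μ) • (x - w) ∈ frechetSubdiff r w := by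
  refine ⟨ne_top_of_mem_proxSet hr hw, fun δ hδ => ?_⟩
  -- Optimality of `w` supports r from below up to ‖y - w‖²/(2μ), which is at most δ‖y - w‖ in this
  -- ball.
  have hnear : ∀ᶠ y in nhds w, ‖y - w‖ < 2 * μ * δ := by
    have := Metric.ball_mem_nhds w (show 0 < 2 * μ * δ by positivity)
    filter_upwards [this] with y hy
    simpa [dist_eq_norm] using hy
  filter_upwards [hnear] with y hy
  have h1 := hw y
  unfold proxObjective at h1
  rw [← coe_toReal_of_mem_proxSet hr hw] at h1 ⊢
  rcases eq_or_ne (r y) ⊤ with htop | htop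
  · rw [htop]; exact le_top
  lift r y to ℝ using ⟨htop, hr.1 y⟩ with b
  norm_cast at h1 ⊢
  have e1 : y - x = (y - w) - (x - w) := by abel
  have e2 : ‖w - x‖ = ‖x - w‖ := norm_sub_rev _ _
  rw [e1, e2, norm_sub_sq_real (y - w), real_inner_comm] at h1
  rw [inner_smul_left]
  simp only [one_div, conj_trivial]
  have h3 : ‖y - w‖ ^ 2 / (2 * μ) ≤ δ * ‖y - w‖ := by
    rw [div_le_iff₀ (by positivity)]
    nlinarith [norm_nonneg (y - w)]
  have h4 : (‖y - w‖ ^ 2 - 2 * inner ℝ (x - w) (y - w) + ‖x - w‖ ^ 2) / (2 * μ)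
      = ‖y - w‖ ^ 2 / (2 * μ) - μ⁻¹ * inner ℝ (x - w) (y - w) + ‖x - w‖ ^ 2 / (2 * μ) := by
    field_simp
  rw [h4] at h1
  linarith

end Prox

/-! ### One stage of the DC algorithm -/

/-- `z x` is the minimizer of the strongly convex function of the stage started at `x`. -/
def IsStageMin {d : ℕ} (g h : Vec d → ℝ) (μ γ : ℝ) (p z : Vec d → Vec d) : Prop :=
  ∀ x, gradient g (z x) + (1 / μ + γ) • z x = gradient h x + (1 / μ) • p x + γ • x

/-- Stationarity is the fixed-point equation of z ↦ σ⁻¹(q - ∇g z), a contraction of ratio L/σ ≤ 1/2.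
Its solution is Lipschitz in `q`, which gives measurability. -/
theorem exists_measurable_isStageMin {d : ℕ} {g : Vec d → ℝ} {L μ γ : ℝ} (h : Vec d → ℝ)
    (hgL : LSmooth L g) (hL : 0 < L) (hσ : 2 * L ≤ 1 / μ + γ) {p : Vec d → Vec d}
    (hp : Measurable p) : ∃ z, Measurable z ∧ IsStageMin g h μ γ p z := by
  set σ := 1 / μ + γ with hσdef
  have hσ0 : 0 < σ := by linarith
  have hex : ∀ q : Vec d, ∃ z, gradient g z + σ • z = q := fun q => by
    have hc : ContractingWith (1 / 2) (fun z : Vec d => σ⁻¹ • (q - gradient g z)) := by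
      refine ⟨by norm_num, LipschitzWith.of_dist_le_mul fun x y => ?_⟩
      rw [dist_eq_norm, dist_eq_norm, ← smul_sub, norm_smul, sub_sub_sub_cancel_left,
        Real.norm_of_nonneg (inv_nonneg.2 hσ0.le)]
      have h1 := hgL.2 y x
      rw [norm_sub_rev y x] at h1
      push_cast
      rw [inv_mul_le_iff₀ hσ0]
      nlinarith [norm_nonneg (x - y)]
    have hfix := hc.fixedPoint_isFixedPt
    refine ⟨ContractingWith.fixedPoint _ hc, ?_⟩
    set z := ContractingWith.fixedPoint _ hc
    have h2 : σ • z = q - gradient g z := by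
      conv_lhs => rw [← hfix]
      rw [smul_smul, mul_inv_cancel₀ hσ0.ne', one_smul]
    rw [h2]; abel
  choose ψ hψ using hex
  have hlip : LipschitzWith (Real.toNNReal (2 / σ)) ψ := LipschitzWith.of_dist_le' fun q q' => by
    rw [dist_eq_norm, dist_eq_norm]
    have h1 : σ • (ψ q - ψ q') = (q - q') - (gradient g (ψ q) - gradient g (ψ q')) := by
      have h2 : σ • ψ q = q - gradient g (ψ q) := eq_sub_of_add_eq' (hψ q)
      have h3 : σ • ψ q' = q' - gradient g (ψ q') := eq_sub_of_add_eq' (hψ q')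
      rw [smul_sub, h2, h3]; abel
    have h2 : σ * ‖ψ q - ψ q'‖ ≤ ‖q - q'‖ + L * ‖ψ q - ψ q'‖ := by
      have := congrArg norm h1
      rw [norm_smul, Real.norm_of_nonneg hσ0.le] at this
      rw [this]
      exact (norm_sub_le _ _).trans (by gcongr; exact hgL.2 _ _)
    rw [div_mul_eq_mul_div, le_div_iff₀ hσ0]
    nlinarith [norm_nonneg (ψ q - ψ q')]
  refine ⟨fun x => ψ (gradient h x + (1 / μ) • p x + γ • x), hlip.continuous.measurable.comp ?_,
    fun x => hψ _⟩
  exact ((measurable_gradient h).add (hp.const_smul (1 / μ))).add (measurable_id.const_smul γ)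

section Stage

variable {d : ℕ} {g h : Vec d → ℝ} {r : Vec d → EReal} {L μ γ : ℝ} {p z : Vec d → Vec d}

/-- Add the support lines of h at `x` and of g at `z x`, the smoothness bound of g at `z x`, and the
competitor bound for the envelope. Stationarity cancels the linear terms except γ⟨X, Y⟩, which
Young's inequality splits; 2L ≤ σ absorbs the smoothness term. -/
theorem envObj_add_le (hg : ConvexOn ℝ Set.univ g) (hgL : LSmooth L g)
    (hh : ConvexOn ℝ Set.univ h) (hhd : Differentiable ℝ h) (hr : ProperLsc r)
    (hp : ∀ x, p x ∈ proxSet r μ x) (hγ : 0 < γ) (hσ : 2 * L ≤ 1 / μ + γ)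
    (hz : IsStageMin g h μ γ p z) (x y : Vec d) :
    envObj g h r μ p y + (1 / μ + γ) / 2 * ‖x - z x‖ ^ 2
      ≤ envObj g h r μ p x + (1 / μ + γ) * ‖y - z x‖ ^ 2 := by
  have h1 := hh.add_inner_gradient_le hhd x y
  have h2 := moreauVal_le hr hp x y
  have h3 := hg.le_add_inner_gradient_add_sq hgL (z x) y
  have h4 := hg.add_inner_gradient_le hgL.1 (z x) x
  have hz' := hz x
  unfold envObj
  have hm : moreauVal r μ p x = ‖p x - x‖ ^ 2 / (2 * μ) + (r (p x)).toReal := rfl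
  rw [hm]
  set c := z x
  obtain ⟨Y, rfl⟩ : ∃ Y, y = c + Y := ⟨y - c, by abel⟩
  obtain ⟨X, hX⟩ : ∃ X, x = c + X := ⟨x - c, by abel⟩
  obtain ⟨w, hw⟩ : ∃ w, p x = c + w := ⟨p x - c, by abel⟩
  have e1 : x - c = X := by rw [hX]; abel
  have e2 : c + Y - c = Y := by abel
  have e3 : c + Y - x = Y - X := by rw [hX]; abel
  have e4 : p x - (c + Y) = w - Y := by rw [hw]; abel
  have e5 : p x - x = w - X := by rw [hw, hX]; abel
  -- Stationarity in coordinates centered at `c = z x`.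
  have hgc : gradient g c = gradient h x + (1 / μ) • w + γ • X := by
    rw [hw] at hz'
    conv at hz' => rhs; rw [add_assoc]; arg 2; arg 2; rw [hX]
    rw [← sub_eq_zero] at hz' ⊢
    rw [← hz']
    module
  rw [e3] at h1
  rw [e4] at h2
  rw [e2, hgc] at h3
  rw [e1, hgc] at h4
  rw [e1, e2, e5]
  simp only [inner_add_left, inner_smul_left, inner_sub_right, conj_trivial] at h1 h3 h4
  rw [norm_sub_sq_real] at h2
  rw [norm_sub_sq_real w X]
  have h5 : 2 * inner ℝ X Y ≤ ‖X‖ ^ 2 + ‖Y‖ ^ 2 := by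
    nlinarith [norm_sub_sq_real X Y, sq_nonneg ‖X - Y‖]
  rw [real_inner_self_eq_norm_sq] at h4
  have h6 : (‖w‖ ^ 2 - 2 * inner ℝ w Y + ‖Y‖ ^ 2) / (2 * μ)
      = ‖w‖ ^ 2 / (2 * μ) - 1 / μ * inner ℝ w Y + 1 / μ * ‖Y‖ ^ 2 / 2 := by
    simp only [div_eq_mul_inv, mul_inv]; ring
  have h7 : (‖w‖ ^ 2 - 2 * inner ℝ w X + ‖X‖ ^ 2) / (2 * μ)
      = ‖w‖ ^ 2 / (2 * μ) - 1 / μ * inner ℝ w X + 1 / μ * ‖X‖ ^ 2 / 2 := by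
    simp only [div_eq_mul_inv, mul_inv]; ring
  rw [h6] at h2
  rw [h7]
  have h8 := mul_le_mul_of_nonneg_left h5 hγ.le
  have h9 := mul_le_mul_of_nonneg_right hσ (sq_nonneg ‖Y‖)
  set m := 1 / μ
  nlinarith

/-- Inserting stationarity of `z x` into the residual of the subgradient (x - p x)/μ leaves
increments of ∇h and ∇g and the term σ(x - z x). The absolute value is there because `H` has no
assumed sign. -/
theorem criticality_le (hgL : LSmooth L g) (hL : 0 < L) {H ν : ℝ} (hhH : HolderGradient H ν h)
    (hr : ProperLsc r) (hμ : 0 < μ) (hγ : 0 < γ) (hp : ∀ x, p x ∈ proxSet r μ x)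
    (hz : IsStageMin g h μ γ p z) (x : Vec d) :
    criticality g h r (p x) ≤ ENNReal.ofReal (|H| * ‖x - p x‖ ^ ν + L * ‖x - p x‖
      + (L + (1 / μ + γ)) * ‖x - z x‖) := by
  have hmem : gradient g (p x) + (1 / μ) • (x - p x) ∈
      (fun v => gradient g (p x) + v) '' frechetSubdiff r (p x) :=
    ⟨_, smul_sub_mem_frechetSubdiff hr hμ (hp x), rfl⟩
  refine (Metric.infEDist_le_edist_of_mem hmem).trans ?_
  rw [edist_dist, dist_eq_norm]
  apply ENNReal.ofReal_le_ofReal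
  have h1 : gradient h (p x) - (gradient g (p x) + (1 / μ) • (x - p x))
      = -(gradient h x - gradient h (p x)) + (gradient g (z x) - gradient g (p x))
        - (1 / μ + γ) • (x - z x) := by
    have := hz x
    rw [← sub_eq_zero] at this ⊢
    rw [← neg_eq_zero, ← this]
    module
  have hσ0 : 0 < 1 / μ + γ := by positivity
  have h2 : ‖gradient h x - gradient h (p x)‖ ≤ |H| * ‖x - p x‖ ^ ν :=
    (hhH.2 _ _).trans (by gcongr; exact le_abs_self H)
  have h3 : ‖gradient g (z x) - gradient g (p x)‖ ≤ L * (‖x - z x‖ + ‖x - p x‖) :=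
    (hgL.2 _ _).trans (by
      gcongr
      rw [norm_sub_rev x (z x)]
      exact norm_sub_le_norm_sub_add_norm_sub _ _ _)
  rw [h1]
  refine (norm_sub_le _ _).trans ?_
  rw [norm_smul, Real.norm_of_nonneg hσ0.le]
  have h4 := norm_add_le (-(gradient h x - gradient h (p x))) (gradient g (z x) - gradient g (p x))
  rw [norm_neg] at h4
  linarith

end Stage

/-! ### Averaging over a random stage -/

/-- Power mean inequality (∑ j)^α ≤ K^(α-1) ∑ j^α together with ∑ j ≥ K²/2. -/
theorem le_sum_rpow {K : ℕ} (hK : 0 < K) {α : ℝ} (hα : 1 ≤ α) :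
    (K : ℝ) * (K : ℝ) ^ α ≤ 2 ^ α * ∑ j ∈ Finset.Icc 1 K, (j : ℝ) ^ α := by
  have hK0 : (0 : ℝ) < K := by exact_mod_cast hK
  have hsum : ((K : ℝ) * K) / 2 ≤ ∑ j ∈ Finset.Icc 1 K, |(j : ℝ)| := by
    have : ∀ n : ℕ, ((n : ℝ) * n) / 2 ≤ ∑ j ∈ Finset.Icc 1 n, |(j : ℝ)| := fun n => by
      induction n with
      | zero => simp
      | succ n ih =>
        rw [Finset.sum_Icc_succ_top (by omega), Nat.abs_cast]
        push_cast
        linarith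
    exact this K
  have h2 := Real.rpow_sum_le_const_mul_sum_rpow (Finset.Icc 1 K) (fun j : ℕ => (j : ℝ)) hα
  have h3 : (((K : ℝ) * K) / 2) ^ α ≤ (∑ j ∈ Finset.Icc 1 K, |(j : ℝ)|) ^ α :=
    Real.rpow_le_rpow (by positivity) hsum (by linarith)
  have h4 := h3.trans h2
  simp only [Nat.abs_cast, Nat.card_Icc, Nat.add_sub_cancel] at h4
  rw [Real.div_rpow (by positivity) (by norm_num), Real.mul_rpow hK0.le hK0.le,
    div_le_iff₀ (by positivity), Real.rpow_sub_one hK0.ne'] at h4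
  have h5 : 0 < (K : ℝ) ^ α := by positivity
  have h6 : (K : ℝ) ^ α * ((K : ℝ) * (K : ℝ) ^ α) ≤ (K : ℝ) ^ α *
      (2 ^ α * ∑ j ∈ Finset.Icc 1 K, (j : ℝ) ^ α) := by
    calc _ = (K : ℝ) * ((K : ℝ) ^ α * (K : ℝ) ^ α) := by ring
      _ ≤ K * ((K : ℝ) ^ α / K * (∑ j ∈ Finset.Icc 1 K, (j : ℝ) ^ α) * 2 ^ α) := by gcongr
      _ = _ := by field_simp
  exact le_of_mul_le_mul_left h6 h5

theorem sum_rpow_pos {K : ℕ} (hK : 0 < K) (α : ℝ) :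
    0 < ∑ j ∈ Finset.Icc 1 K, (j : ℝ) ^ α :=
  Finset.sum_pos (fun j hj => by
    have : 0 < j := (Finset.mem_Icc.1 hj).1
    positivity) ⟨1, by simp; omega⟩

theorem rpow_div_sum_rpow_le {K k : ℕ} (hk : k ∈ Finset.Icc 1 K) {α : ℝ} (hα : 1 ≤ α) :
    (k : ℝ) ^ α / ∑ j ∈ Finset.Icc 1 K, (j : ℝ) ^ α ≤ 2 ^ α / K := by
  have hk' := Finset.mem_Icc.1 hk
  have hK : 0 < K := by omega
  have h1 := le_sum_rpow hK hα
  have h2 : (k : ℝ) ^ α ≤ (K : ℝ) ^ α :=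
    Real.rpow_le_rpow (by positivity) (by exact_mod_cast hk'.2) (by linarith)
  rw [div_le_div_iff₀ (sum_rpow_pos hK α) (by exact_mod_cast hK)]
  nlinarith [Nat.cast_nonneg (α := ℝ) K]

/-- On {τ = k} only `X k` is read, so independence of τ from each `X k` separately suffices. -/
theorem lintegral_stageIndex {Ω E : Type*} [MeasurableSpace Ω] [MeasurableSpace E] {P : Measure Ω}
    [IsProbabilityMeasure P] {K : ℕ} (hK : 0 < K) {α : ℝ} {τ : Ω → ℕ} (hτ : IsStageIndex P K α τ)
    {X : ℕ → Ω → E} (hX : ∀ k, Measurable (X k)) (hind : ∀ k, 1 ≤ k → IndepFun τ (X k) P)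
    {f : E → ℝ≥0∞} (hf : Measurable f) :
    ∫⁻ ω, f (X (τ ω) ω) ∂P = ∑ k ∈ Finset.Icc 1 K,
      ENNReal.ofReal ((k : ℝ) ^ α / ∑ j ∈ Finset.Icc 1 K, (j : ℝ) ^ α) * ∫⁻ ω, f (X k ω) ∂P := by
  have hpos := sum_rpow_pos hK α
  have hms : ∀ k, MeasurableSet {ω | τ ω = k} := fun k => hτ.1 (measurableSet_singleton k)
  have hae : ∀ᵐ ω ∂P, τ ω ∈ Finset.Icc 1 K := by
    have h1 : P (⋃ k ∈ Finset.Icc 1 K, {ω | τ ω = k}) = 1 := by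
      rw [measure_biUnion_finset (fun i _ j _ hij => Set.disjoint_left.2 fun ω hi hj =>
        hij (hi.symm.trans hj)) (fun k _ => hms k), Finset.sum_congr rfl hτ.2,
        ← ENNReal.ofReal_sum_of_nonneg (fun k _ => by positivity), ← Finset.sum_div,
        div_self hpos.ne', ENNReal.ofReal_one]
    have h2 : MeasurableSet (⋃ k ∈ Finset.Icc 1 K, {ω | τ ω = k}) :=
      Finset.measurableSet_biUnion _ fun k _ => hms k
    have h3 := (prob_compl_eq_zero_iff h2).2 h1
    filter_upwards [compl_mem_ae_iff.2 h3] with ω hω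
    simpa using hω
  calc ∫⁻ ω, f (X (τ ω) ω) ∂P
      = ∫⁻ ω, ∑ k ∈ Finset.Icc 1 K, (({k} : Set ℕ).indicator 1 (τ ω)) * f (X k ω) ∂P := by
        refine lintegral_congr_ae ?_
        filter_upwards [hae] with ω hω
        rw [Finset.sum_eq_single_of_mem _ hω fun k _ hk => by
          rw [Set.indicator_of_notMem (by simpa using hk.symm), zero_mul]]
        simp
    _ = ∑ k ∈ Finset.Icc 1 K, ∫⁻ ω, (({k} : Set ℕ).indicator 1 (τ ω)) * f (X k ω) ∂P :=
        lintegral_finsetSum _ fun k _ =>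
          ((measurable_one.indicator (measurableSet_singleton k)).comp hτ.1).mul (hf.comp (hX k))
    _ = _ := by
        refine Finset.sum_congr rfl fun k hk => ?_
        have hi : Measurable (({k} : Set ℕ).indicator (1 : ℕ → ℝ≥0∞)) :=
          measurable_one.indicator (measurableSet_singleton k)
        have := lintegral_mul_eq_lintegral_mul_lintegral_of_indepFun (μ := P)
          (hi.comp hτ.1) (hf.comp (hX k))
          ((hind k (Finset.mem_Icc.1 hk).1).comp hi hf)
        simp only [Pi.mul_apply, Function.comp_apply] at this
        rw [this, ← hτ.2 k hk]
        congr 1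
        rw [← lintegral_indicator_one (hms k)]
        rfl

/-! ### Descent over the stages -/

/-- The first alternative allows a first stage that does not move, as in SVRG, where ⌈log₂ 1⌉ = 0.
Its `V 1 / 4` is paid by `V 1 ≤ 2 * A 1`, whence the factor 3/2. -/
theorem stage_recursion {A V β : ℕ → ℝ} (hA : ∀ k, 0 ≤ A k) (hVA : ∀ k, 1 ≤ k → V k ≤ 2 * A k)
    (hV : ∀ k, 0 ≤ V k) (hβ : ∀ k, 0 ≤ β k)
    (hrec : ∀ k, 1 ≤ k → (k = 1 ∧ A 2 = A 1) ∨ A (k + 1) + V k / 4 ≤ A k + β k) (n : ℕ) :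
    A (n + 1) + (∑ k ∈ Finset.Icc 1 n, V k) / 4
      ≤ 3 / 2 * A 1 + ∑ k ∈ Finset.Icc 1 n, β k := by
  have h : A (n + 1) + (∑ k ∈ Finset.Icc 1 n, V k) / 4
      ≤ A 1 + (if n = 0 then 0 else V 1 / 4) + ∑ k ∈ Finset.Icc 1 n, β k := by
    induction n with
    | zero => simp
    | succ n ih =>
      rw [Finset.sum_Icc_succ_top (by omega), Finset.sum_Icc_succ_top (by omega),
        if_neg (by omega)]
      have h1 := hβ (n + 1)
      have h2 := hV 1
      rcases hrec (n + 1) (by omega) with ⟨h3, h4⟩ | h3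
      · obtain rfl : n = 0 := by omega
        norm_num at ih h1 ⊢
        linarith
      · split_ifs at ih <;> linarith
  have h1 := hVA 1 le_rfl
  have h2 := hA 1
  split_ifs at h <;> linarith

theorem sum_inv_le_one_add_log (n : ℕ) : ∑ k ∈ Finset.Icc 1 n, ((k : ℝ))⁻¹ ≤ 1 + Real.log n := by
  have := harmonic_le_one_add_log n
  rw [harmonic_eq_sum_Icc] at this
  push_cast at this
  exact this

section Stages

variable {d : ℕ} {Ω : Type*} [MeasurableSpace Ω] {P : Measure Ω} [IsProbabilityMeasure P]

/-- Of the gain V/2 in the descent inequality, the stage error consumes V/4; the remaining V/4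
telescopes, and ∑ 1/k gives the logarithm. -/
theorem lintegral_descent {D : Vec d → ℝ} (hD : ∀ x, 0 ≤ D x) (hDm : Measurable D)
    {z : Vec d → Vec d} (hzm : Measurable z) {σ B : ℝ} (hσ : 0 < σ) (hB : 0 ≤ B)
    (hdesc : ∀ x y, D y + σ / 2 * ‖x - z x‖ ^ 2 ≤ D x + σ * ‖y - z x‖ ^ 2)
    {X : ℕ → Ω → Vec d} (hX : ∀ k, Measurable (X k)) {x₁ : Vec d} (hX1 : X 1 = fun _ => x₁)
    (hstage : ∀ k, 1 ≤ k → (k = 1 ∧ X 2 = X 1) ∨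
      ∫⁻ ω, ‖X (k + 1) ω - z (X k ω)‖ₑ ^ 2 ∂P
        ≤ 4⁻¹ * ∫⁻ ω, ‖X k ω - z (X k ω)‖ₑ ^ 2 ∂P + ENNReal.ofReal (B / (σ ^ 2 * k)))
    (K : ℕ) :
    (∀ k ∈ Finset.Icc 1 K, ∫⁻ ω, ENNReal.ofReal (D (X k ω)) ∂P
      ≤ ENNReal.ofReal (3 / 2 * D x₁ + B / σ * (1 + Real.log K))) ∧
    ∑ k ∈ Finset.Icc 1 K, ∫⁻ ω, ENNReal.ofReal (σ * ‖X k ω - z (X k ω)‖ ^ 2) ∂P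
      ≤ ENNReal.ofReal (4 * (3 / 2 * D x₁ + B / σ * (1 + Real.log K))) := by
  set a : ℕ → ℝ≥0∞ := fun k => ∫⁻ ω, ENNReal.ofReal (D (X k ω)) ∂P with ha
  set v : ℕ → ℝ≥0∞ := fun k => ∫⁻ ω, ENNReal.ofReal (σ * ‖X k ω - z (X k ω)‖ ^ 2) ∂P with hv
  set β : ℕ → ℝ := fun k => B / σ * ((k : ℝ))⁻¹ with hβ
  have hβ0 : ∀ k, 0 ≤ β k := fun k => by positivity
  have hconv : ∀ Y : Ω → Vec d, Measurable Y →
      ∫⁻ ω, ENNReal.ofReal (σ * ‖Y ω‖ ^ 2) ∂P = ENNReal.ofReal σ * ∫⁻ ω, ‖Y ω‖ₑ ^ 2 ∂P := by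
    intro Y hY
    rw [← lintegral_const_mul _ (hY.enorm.pow_const 2)]
    refine lintegral_congr fun ω => ?_
    rw [ENNReal.ofReal_mul hσ.le, ENNReal.ofReal_pow (norm_nonneg _), ofReal_norm]
  have hmD : ∀ k, Measurable fun ω => ENNReal.ofReal (D (X k ω)) :=
    fun k => (hDm.comp (hX k)).ennreal_ofReal
  have hva : ∀ k, v k ≤ 2 * a k := fun k => by
    simp only [ha, hv]
    rw [← lintegral_const_mul _ (hmD k)]
    refine lintegral_mono fun ω => ?_
    have e2 : (2 : ℝ≥0∞) * ENNReal.ofReal (D (X k ω)) = ENNReal.ofReal (2 * D (X k ω)) := by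
      rw [ENNReal.ofReal_mul (by norm_num), ENNReal.ofReal_ofNat]
    rw [e2]
    apply ENNReal.ofReal_le_ofReal
    -- With y = z x the error on the right vanishes, so σ‖x - z x‖² ≤ 2 D x.
    have := hdesc (X k ω) (z (X k ω))
    rw [sub_self, norm_zero] at this
    linarith [hD (z (X k ω))]
  have hstep : ∀ k, 1 ≤ k → (k = 1 ∧ a 2 = a 1) ∨
      a (k + 1) + 2⁻¹ * v k ≤ a k + (4⁻¹ * v k + ENNReal.ofReal (β k)) := fun k hk => by
    rcases hstage k hk with ⟨h1, h2⟩ | h1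
    · exact Or.inl ⟨h1, by simp only [ha, h2]⟩
    · right
      have h2 : a (k + 1) + 2⁻¹ * v k
          ≤ a k + ∫⁻ ω, ENNReal.ofReal (σ * ‖X (k + 1) ω - z (X k ω)‖ ^ 2) ∂P := by
        have hm1 : Measurable fun ω => ENNReal.ofReal (σ * ‖X k ω - z (X k ω)‖ ^ 2) :=
          ((((hX k).sub (hzm.comp (hX k))).norm.pow_const 2).const_mul σ).ennreal_ofReal
        simp only [ha, hv]
        rw [← lintegral_const_mul _ hm1, ← lintegral_add_left (hmD _),
          ← lintegral_add_left (hmD _)]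
        refine lintegral_mono fun ω => ?_
        have h3 := hdesc (X k ω) (X (k + 1) ω)
        have e2 : (2 : ℝ≥0∞)⁻¹ = ENNReal.ofReal (2⁻¹) := by
          rw [ENNReal.ofReal_inv_of_pos (by norm_num), ENNReal.ofReal_ofNat]
        rw [e2, ← ENNReal.ofReal_mul (by norm_num), ← ENNReal.ofReal_add (hD _) (by positivity),
          ← ENNReal.ofReal_add (hD _) (by positivity)]
        apply ENNReal.ofReal_le_ofReal
        linarith
      refine h2.trans ?_
      gcongr
      rw [hconv (fun ω => X (k + 1) ω - z (X k ω)) ((hX _).sub (hzm.comp (hX k)))]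
      calc _ ≤ ENNReal.ofReal σ * (4⁻¹ * ∫⁻ ω, ‖X k ω - z (X k ω)‖ₑ ^ 2 ∂P
            + ENNReal.ofReal (B / (σ ^ 2 * k))) := by gcongr
        _ = _ := by
          rw [mul_add, mul_left_comm, ← hconv (fun ω => X k ω - z (X k ω)) ((hX k).sub (hzm.comp (hX k))),
            ← ENNReal.ofReal_mul hσ.le]
          congr 2
          simp only [hβ, div_eq_mul_inv, mul_inv]
          field_simp
  -- Finiteness of all expectations is needed before moving to reals, where the recursion can be
  -- subtracted.
  have hfin : ∀ n, a (n + 1) ≠ ∞ := fun n => by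
    induction n with
    | zero => simp [ha, hX1]
    | succ n ih =>
      rcases hstep (n + 1) (by omega) with ⟨h1, h2⟩ | h1
      · obtain rfl : n = 0 := by omega
        rw [h2]; exact ih
      · have hv : v (n + 1) ≠ ∞ :=
          ne_top_of_le_ne_top (ENNReal.mul_ne_top (by norm_num) ih) (hva _)
        refine ne_top_of_le_ne_top ?_ (le_self_add.trans h1)
        exact ENNReal.add_ne_top.2 ⟨ih, ENNReal.add_ne_top.2
          ⟨ENNReal.mul_ne_top (by norm_num) hv, ENNReal.ofReal_ne_top⟩⟩
  have hfin' : ∀ k, 1 ≤ k → a k ≠ ∞ := fun k hk => by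
    obtain ⟨n, rfl⟩ : ∃ n, k = n + 1 := ⟨k - 1, by omega⟩
    exact hfin n
  have hvfin : ∀ k, 1 ≤ k → v k ≠ ∞ := fun k hk =>
    ne_top_of_le_ne_top (ENNReal.mul_ne_top (by norm_num) (hfin' k hk)) (hva _)
  have hkey := stage_recursion (A := fun k => (a k).toReal) (V := fun k => (v k).toReal) (β := β)
    (fun k => ENNReal.toReal_nonneg) (fun k hk => by
      have := ENNReal.toReal_mono (ENNReal.mul_ne_top (by norm_num) (hfin' k hk)) (hva k)
      simpa using this) (fun k => ENNReal.toReal_nonneg) hβ0 (fun k hk => by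
      rcases hstep k hk with ⟨h1, h2⟩ | h1
      · exact Or.inl ⟨h1, by simp only [h2]⟩
      · right
        have h2 : 2⁻¹ * v k ≠ ∞ := ENNReal.mul_ne_top (by norm_num) (hvfin k hk)
        have h4 : 4⁻¹ * v k ≠ ∞ := ENNReal.mul_ne_top (by norm_num) (hvfin k hk)
        have h3 := ENNReal.toReal_mono (ENNReal.add_ne_top.2 ⟨hfin' k hk, ENNReal.add_ne_top.2
          ⟨h4, ENNReal.ofReal_ne_top⟩⟩) h1
        rw [ENNReal.toReal_add (hfin k) h2, ENNReal.toReal_add (hfin' k hk)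
          (ENNReal.add_ne_top.2 ⟨h4, ENNReal.ofReal_ne_top⟩),
          ENNReal.toReal_add h4 ENNReal.ofReal_ne_top, ENNReal.toReal_ofReal (hβ0 k)] at h3
        simp only [ENNReal.toReal_mul, ENNReal.toReal_inv, ENNReal.toReal_ofNat] at h3
        linarith)
  have ha1 : (a 1).toReal = D x₁ := by simp [ha, hX1, hD]
  simp only [ha1] at hkey
  have hβsum : ∀ n ≤ K, ∑ k ∈ Finset.Icc 1 n, β k ≤ B / σ * (1 + Real.log K) := fun n hn => by
    calc ∑ k ∈ Finset.Icc 1 n, β k ≤ ∑ k ∈ Finset.Icc 1 K, β k :=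
          Finset.sum_le_sum_of_subset_of_nonneg (Finset.Icc_subset_Icc_right hn)
            fun k _ _ => hβ0 k
      _ = B / σ * ∑ k ∈ Finset.Icc 1 K, ((k : ℝ))⁻¹ := by rw [Finset.mul_sum]
      _ ≤ _ := by gcongr; exact sum_inv_le_one_add_log K
  have hV0 : ∀ n, 0 ≤ ∑ k ∈ Finset.Icc 1 n, (v k).toReal :=
    fun n => Finset.sum_nonneg fun k _ => ENNReal.toReal_nonneg
  constructor
  · intro k hk
    obtain ⟨n, rfl⟩ : ∃ n, k = n + 1 := ⟨k - 1, by have := (Finset.mem_Icc.1 hk).1; omega⟩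
    have hn : n ≤ K := by have := (Finset.mem_Icc.1 hk).2; omega
    change a (n + 1) ≤ _
    rw [← ENNReal.ofReal_toReal (hfin n)]
    apply ENNReal.ofReal_le_ofReal
    linarith [hkey n, hβsum n hn, hV0 n]
  · have hne : ∀ k ∈ Finset.Icc 1 K, v k ≠ ∞ := fun k hk => hvfin k (Finset.mem_Icc.1 hk).1
    rw [← ENNReal.ofReal_toReal (ENNReal.sum_ne_top.2 hne), ENNReal.toReal_sum hne]
    apply ENNReal.ofReal_le_ofReal
    have h0 : 0 ≤ (a (K + 1)).toReal := ENNReal.toReal_nonneg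
    linarith [hkey K, hβsum K le_rfl]

/-- The `D` part uses the bound valid at every stage and weights of total mass 1; the other part
uses the bound on the sum over stages and weights at most 2^α/K. -/
theorem lintegral_stageIndex_le {D : Vec d → ℝ} (hD : ∀ x, 0 ≤ D x) (hDm : Measurable D)
    {z : Vec d → Vec d} (hzm : Measurable z) {σ B : ℝ} (hσ : 0 < σ) (hB : 0 ≤ B)
    (hdesc : ∀ x y, D y + σ / 2 * ‖x - z x‖ ^ 2 ≤ D x + σ * ‖y - z x‖ ^ 2)
    {X : ℕ → Ω → Vec d} (hX : ∀ k, Measurable (X k)) {x₁ : Vec d} (hX1 : X 1 = fun _ => x₁)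
    (hstage : ∀ k, 1 ≤ k → (k = 1 ∧ X 2 = X 1) ∨
      ∫⁻ ω, ‖X (k + 1) ω - z (X k ω)‖ₑ ^ 2 ∂P
        ≤ 4⁻¹ * ∫⁻ ω, ‖X k ω - z (X k ω)‖ₑ ^ 2 ∂P + ENNReal.ofReal (B / (σ ^ 2 * k)))
    {K : ℕ} (hK : 0 < K) {α : ℝ} (hα : 1 ≤ α) {τ : Ω → ℕ} (hτ : IsStageIndex P K α τ)
    (hind : ∀ k, 1 ≤ k → IndepFun τ (X k) P) {κ : ℝ} (hκ : 0 ≤ κ) {M : ℝ}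
    (hM : 3 / 2 * D x₁ + B / σ * (1 + Real.log K) ≤ M) :
    ∫⁻ ω, ENNReal.ofReal (1 + D (X (τ ω) ω)
        + κ * (σ * ‖X (τ ω) ω - z (X (τ ω) ω)‖ ^ 2)) ∂P
      ≤ ENNReal.ofReal (1 + M + κ * (2 ^ α / K) * (4 * M)) := by
  have hK0 : (0 : ℝ) < K := by exact_mod_cast hK
  obtain ⟨h1, h2⟩ := lintegral_descent (P := P) hD hDm hzm hσ hB hdesc hX hX1 hstage K
  have hM0 : 0 ≤ M := by
    refine le_trans ?_ hM
    have := hD x₁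
    have : 0 ≤ Real.log K := Real.log_natCast_nonneg K
    positivity
  have hdm : Measurable fun x => σ * ‖x - z x‖ ^ 2 :=
    ((measurable_id.sub hzm).norm.pow_const 2).const_mul σ
  rw [lintegral_stageIndex hK hτ hX hind
    (f := fun x => ENNReal.ofReal (1 + D x + κ * (σ * ‖x - z x‖ ^ 2)))
    ((measurable_const.add hDm).add (hdm.const_mul κ)).ennreal_ofReal]
  set q : ℕ → ℝ := fun k => (k : ℝ) ^ α / ∑ j ∈ Finset.Icc 1 K, (j : ℝ) ^ α with hq
  have hq0 : ∀ k, 0 ≤ q k := fun k => by have := sum_rpow_pos hK α; positivity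
  have hqs : ∑ k ∈ Finset.Icc 1 K, ENNReal.ofReal (q k) = 1 := by
    rw [← ENNReal.ofReal_sum_of_nonneg (fun k _ => hq0 k), ← Finset.sum_div,
      div_self (sum_rpow_pos hK α).ne', ENNReal.ofReal_one]
  have hterm : ∀ k ∈ Finset.Icc 1 K,
      ENNReal.ofReal (q k) * ∫⁻ ω, ENNReal.ofReal (1 + D (X k ω)
        + κ * (σ * ‖X k ω - z (X k ω)‖ ^ 2)) ∂P
      ≤ ENNReal.ofReal (q k) * ENNReal.ofReal (1 + M)
        + ENNReal.ofReal (κ * (2 ^ α / K)) *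
          ∫⁻ ω, ENNReal.ofReal (σ * ‖X k ω - z (X k ω)‖ ^ 2) ∂P := fun k hk => by
    have e : ∫⁻ ω, ENNReal.ofReal (1 + D (X k ω) + κ * (σ * ‖X k ω - z (X k ω)‖ ^ 2)) ∂P
        = 1 + ∫⁻ ω, ENNReal.ofReal (D (X k ω)) ∂P
          + ENNReal.ofReal κ * ∫⁻ ω, ENNReal.ofReal (σ * ‖X k ω - z (X k ω)‖ ^ 2) ∂P := by
      have hmD : Measurable fun ω => ENNReal.ofReal (D (X k ω)) :=
        (hDm.comp (hX k)).ennreal_ofReal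
      have hmU : Measurable fun ω => ENNReal.ofReal (σ * ‖X k ω - z (X k ω)‖ ^ 2) :=
        (hdm.comp (hX k)).ennreal_ofReal
      have h1 : (1 : ℝ≥0∞) = ∫⁻ ω, 1 ∂P := by simp
      rw [← lintegral_const_mul _ hmU, h1, ← lintegral_add_left measurable_const,
        ← lintegral_add_left (by exact measurable_const.add hmD)]
      refine lintegral_congr fun ω => ?_
      have := hD (X k ω)
      rw [ENNReal.ofReal_add (by positivity) (by positivity), ENNReal.ofReal_add (by positivity)
        (by positivity), ENNReal.ofReal_mul hκ, ENNReal.ofReal_one]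
    rw [e, mul_add]
    refine add_le_add ?_ ?_
    · rw [ENNReal.ofReal_add zero_le_one hM0, ENNReal.ofReal_one]
      gcongr
      exact (h1 k hk).trans (ENNReal.ofReal_le_ofReal hM)
    · rw [← mul_assoc, ← ENNReal.ofReal_mul (hq0 k)]
      refine mul_le_mul_left (ENNReal.ofReal_le_ofReal ?_) _
      rw [mul_comm]
      exact mul_le_mul_of_nonneg_left (rpow_div_sum_rpow_le hk hα) hκ
  refine (Finset.sum_le_sum hterm).trans ?_
  rw [Finset.sum_add_distrib, ← Finset.sum_mul, hqs, one_mul, ← Finset.mul_sum,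
    ENNReal.ofReal_add (p := 1 + M) (by positivity) (by positivity),
    ENNReal.ofReal_mul (p := κ * (2 ^ α / K)) (by positivity)]
  refine add_le_add le_rfl (mul_le_mul_right ?_ _)
  exact h2.trans (ENNReal.ofReal_le_ofReal (by linarith))

end Stages

/-! ### Bounds on the smoothed objective -/

/-- For `μ = ε ^ m` and small `ε`, the gap of the smoothed objective at `x₁` is bounded, and the
gap at `x` controls the distance of `x` to its proximal point at the scale `ε`. -/
def EnvBounds {d : ℕ} (g h : Vec d → ℝ) (r : Vec d → EReal) (x₁ : Vec d) (m : ℕ) : Prop :=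
  ∃ C ε₁ : ℝ, 0 < C ∧ 0 < ε₁ ∧ ∀ (ε : ℝ) (p : Vec d → Vec d), 0 < ε → ε ≤ ε₁ →
    (∀ x, p x ∈ proxSet r (ε ^ m) x) → ∃ ℓ : ℝ, envObj g h r (ε ^ m) p x₁ - ℓ ≤ C ∧
      ∀ x, ℓ ≤ envObj g h r (ε ^ m) p x ∧
        ‖x - p x‖ ^ 2 ≤ C * ε ^ 2 * (1 + (envObj g h r (ε ^ m) p x - ℓ))

theorem envObj_le_of_gap {d : ℕ} {g h : Vec d → ℝ} {r : Vec d → EReal} {μ Δ : ℝ} {x₁ : Vec d}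
    {p : Vec d → Vec d} (hr : ProperLsc r) (hp : ∀ x, p x ∈ proxSet r μ x)
    (hgap : ∀ x, smoothedObjective g h r μ x₁ ≤ smoothedObjective g h r μ x + (Δ : EReal))
    (x : Vec d) : envObj g h r μ p x₁ ≤ envObj g h r μ p x + Δ := by
  have := hgap x
  rw [smoothedObjective_eq_envObj hr hp, smoothedObjective_eq_envObj hr hp] at this
  exact_mod_cast this

/-- Comparing the proximal point with `x` itself gives ‖x - p x‖² ≤ 2μM‖x - p x‖, so the
displacement is at most 2Mμ. -/
theorem LipschitzReg.envBounds {d : ℕ} {g h : Vec d → ℝ} {r : Vec d → EReal} {x₁ : Vec d}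
    (hr : ProperLsc r) (hx₁ : BoundedInitialGap g h r x₁) (hlip : LipschitzReg r) :
    EnvBounds g h r x₁ 1 := by
  obtain ⟨ρ, M, hM, hρ⟩ := hlip
  obtain ⟨μ₀, Δ, hμ₀, hgap⟩ := hx₁
  refine ⟨4 * M ^ 2 + |Δ| + 1, μ₀, by positivity, hμ₀, fun ε p hε hεμ hp => ?_⟩
  have hΔ := envObj_le_of_gap hr hp (hgap (ε ^ 1) (by positivity) (by simpa using hεμ))
  refine ⟨envObj g h r (ε ^ 1) p x₁ - |Δ|, ?_, fun x => ⟨?_, ?_⟩⟩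
  · have : (0 : ℝ) ≤ M ^ 2 := by positivity
    linarith
  · linarith [hΔ x, le_abs_self Δ]
  · have h1 := hp x x
    unfold proxObjective at h1
    rw [hρ, hρ] at h1
    norm_cast at h1
    rw [sub_self, norm_zero] at h1
    have h2 : ρ x - ρ (p x) ≤ M * ‖x - p x‖ := by
      have := hM.dist_le_mul x (p x)
      rw [Real.dist_eq, dist_eq_norm] at this
      exact (le_abs_self _).trans this
    rw [norm_sub_rev, pow_one] at h1
    have h3 : ‖x - p x‖ ^ 2 / (2 * ε) ≤ M * ‖x - p x‖ := by
      norm_num at h1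
      linarith
    rw [div_le_iff₀ (by positivity)] at h3
    have h4 : ‖x - p x‖ ≤ 2 * M * ε := by
      rcases (norm_nonneg (x - p x)).eq_or_lt with h0 | h0
      · rw [← h0]; positivity
      · nlinarith
    have h5 : ‖x - p x‖ ^ 2 ≤ (2 * M * ε) ^ 2 := by gcongr
    have h6 : 0 ≤ envObj g h r (ε ^ 1) p x - (envObj g h r (ε ^ 1) p x₁ - |Δ|) := by
      linarith [hΔ x, le_abs_self Δ]
    calc ‖x - p x‖ ^ 2 ≤ (4 * M ^ 2) * ε ^ 2 * 1 := by linarith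
      _ ≤ _ := by
        gcongr
        · linarith [abs_nonneg Δ]
        · linarith

/-- A lower bound on r does not control g - h, so the gap hypothesis is used at 2μ as well: testing
with `p x` gives F_{2μ}(x) ≤ F_μ(x) - ‖x - p x‖²/(4μ), while F_{2μ}(x) ≥ F_{2μ}(x₁) - Δ ≥ A. -/
theorem envBounds_two_of_le {d : ℕ} {g h : Vec d → ℝ} {r : Vec d → EReal} {x₁ : Vec d}
    (hr : ProperLsc r) (hx₁ : BoundedInitialGap g h r x₁) (hbd : ∃ m : ℝ, ∀ x, (m : EReal) ≤ r x) :
    EnvBounds g h r x₁ 2 := by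
  obtain ⟨m, hm⟩ := hbd
  obtain ⟨μ₀, Δ, hμ₀, hgap⟩ := hx₁
  obtain ⟨y₀, hy₀⟩ := hr.2.1
  obtain ⟨b, hb⟩ : ∃ b : ℝ, (b : EReal) = r y₀ := ⟨_, EReal.coe_toReal hy₀ (hr.1 y₀)⟩
  -- a uniform upper bound of the envelope at `x₁` and a uniform lower bound everywhere
  set U := g y₀ - h y₀ + b + |Δ| with hU
  set A := g x₁ - h x₁ + m - |Δ| with hA
  refine ⟨4 * (1 + |U - A|) + |Δ|, min 1 (μ₀ / 2), by positivity, by positivity,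
    fun ε p hε hε₁ hp => ?_⟩
  have hεle : ε ≤ 1 := hε₁.trans (min_le_left _ _)
  have hεμ : 2 * ε ^ 2 ≤ μ₀ := by
    have := hε₁.trans (min_le_right _ _)
    nlinarith
  have hμ : 0 < ε ^ 2 := by positivity
  set F := envObj g h r (ε ^ 2) p with hF
  have hΔ : ∀ x, F x₁ ≤ F x + Δ :=
    envObj_le_of_gap hr hp (hgap (ε ^ 2) hμ (by linarith))
  have hup : F x₁ - |Δ| ≤ U := by
    have h1 := hΔ y₀
    have h2 := moreauVal_le_proxObjective hr hp y₀ y₀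
    unfold proxObjective at h2
    rw [← hb, sub_self, norm_zero] at h2
    norm_cast at h2
    norm_num at h2
    have h3 : F y₀ = g y₀ - h y₀ + moreauVal r (ε ^ 2) p y₀ := rfl
    linarith [le_abs_self Δ, abs_nonneg Δ]
  have hlow : ∀ x, ‖x - p x‖ ^ 2 / (4 * ε ^ 2) ≤ F x - A := fun x => by
    have h1 := hgap (2 * ε ^ 2) (by positivity) hεμ x
    have h2 : ((g x₁ - h x₁ + m : ℝ) : EReal) ≤ smoothedObjective g h r (2 * ε ^ 2) x₁ := by
      unfold smoothedObjective
      rw [EReal.coe_add]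
      refine add_le_add le_rfl (le_iInf fun y => ?_)
      unfold proxObjective
      refine (hm y).trans ?_
      conv_lhs => rw [← zero_add (r y)]
      exact add_le_add (by exact_mod_cast by positivity) le_rfl
    have h3 : smoothedObjective g h r (2 * ε ^ 2) x
        ≤ ((F x - ‖x - p x‖ ^ 2 / (4 * ε ^ 2) : ℝ) : EReal) := by
      unfold smoothedObjective
      have h4 : moreau r (2 * ε ^ 2) x
          ≤ ((‖p x - x‖ ^ 2 / (2 * (2 * ε ^ 2)) + (r (p x)).toReal : ℝ) : EReal) := by
        refine (iInf_le _ (p x)).trans (le_of_eq ?_)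
        unfold proxObjective
        rw [EReal.coe_add, coe_toReal_of_mem_proxSet hr (hp x)]
      refine (add_le_add le_rfl h4).trans (le_of_eq ?_)
      rw [← EReal.coe_add]
      congr 1
      rw [hF, envObj, moreauVal, norm_sub_rev (p x) x]
      field_simp
      ring
    have h5 := h2.trans (h1.trans (add_le_add h3 le_rfl))
    norm_cast at h5
    linarith [le_abs_self Δ]
  refine ⟨F x₁ - |Δ|, ?_, fun x => ⟨by linarith [hΔ x, le_abs_self Δ], ?_⟩⟩
  · have := abs_nonneg (U - A)
    linarith
  · have h1 := hlow x
    rw [div_le_iff₀ (by positivity)] at h1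
    have h2 : 0 ≤ F x - (F x₁ - |Δ|) := by linarith [hΔ x, le_abs_self Δ]
    have h3 := le_abs_self (U - A)
    have h0 := abs_nonneg (U - A)
    -- Split F x - A = (F x - ℓ) + (ℓ - A), where ℓ = F x₁ - |Δ| ≤ U.
    have h4 : F x - A ≤ (1 + |U - A|) * (1 + (F x - (F x₁ - |Δ|))) := by nlinarith
    calc ‖x - p x‖ ^ 2 ≤ (F x - A) * (4 * ε ^ 2) := h1
      _ ≤ ((1 + |U - A|) * (1 + (F x - (F x₁ - |Δ|)))) * (4 * ε ^ 2) := by gcongr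
      _ = (4 * (1 + |U - A|)) * ε ^ 2 * (1 + (F x - (F x₁ - |Δ|))) := by ring
      _ ≤ _ := by
        gcongr
        linarith [abs_nonneg Δ]

/-! ### Convergence from the stage inequalities -/

/-- Linearizing the Hölder term at scale ε leaves only a first moment to estimate. -/
theorem Real.rpow_le_rpow_mul_one_add_div {t ε ν : ℝ} (ht : 0 ≤ t) (hε : 0 < ε) (hν : 0 < ν)
    (hν' : ν ≤ 1) : t ^ ν ≤ ε ^ ν * (1 + t / ε) := by
  have h1 : t ^ ν = ε ^ ν * (t / ε) ^ ν := by
    rw [← Real.mul_rpow hε.le (by positivity), mul_div_cancel₀ _ hε.ne']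
  rw [h1]
  gcongr
  have h0 : 0 ≤ t / ε := by positivity
  rcases le_total (t / ε) 1 with h | h
  · exact (Real.rpow_le_one h0 h hν.le).trans (by linarith)
  · calc (t / ε) ^ ν ≤ (t / ε) ^ (1 : ℝ) := Real.rpow_le_rpow_of_exponent_le h hν'
      _ ≤ _ := by rw [Real.rpow_one]; linarith

/-- The upper bound on `K` makes log K of order log(1/ε), which the factor ε absorbs. -/
theorem mul_one_add_log_le {ε b e : ℝ} {K : ℕ} (hK : 0 < K) (hε : 0 < ε) (hε1 : ε ≤ 1)
    (hb : 0 < b) (he : 0 ≤ e) (hKb : (K : ℝ) ≤ b * ε ^ (-e)) :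
    ε * (1 + Real.log K) ≤ 1 + |Real.log b| + e := by
  have hK0 : (0 : ℝ) < K := by exact_mod_cast hK
  have h1 : Real.log K ≤ Real.log b + e * Real.log ε⁻¹ := by
    refine (Real.log_le_log hK0 hKb).trans (le_of_eq ?_)
    rw [Real.log_mul hb.ne' (by positivity), Real.log_rpow hε, Real.log_inv]
    ring
  have h2 : Real.log ε⁻¹ ≤ ε⁻¹ := Real.log_le_self (by positivity)
  have h3 : ε * Real.log ε⁻¹ ≤ 1 := by
    calc _ ≤ ε * ε⁻¹ := by gcongr
      _ = 1 := mul_inv_cancel₀ hε.ne'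
  have h4 : ε * Real.log b ≤ |Real.log b| := by
    calc _ ≤ ε * |Real.log b| := by gcongr; exact le_abs_self _
      _ ≤ 1 * |Real.log b| := by gcongr
      _ = _ := one_mul _
  calc ε * (1 + Real.log K) ≤ ε * (1 + (Real.log b + e * Real.log ε⁻¹)) := by gcongr
    _ = ε + ε * Real.log b + e * (ε * Real.log ε⁻¹) := by ring
    _ ≤ 1 + |Real.log b| + e * 1 := by gcongr
    _ = _ := by ring

theorem le_mul_of_sq_le_mul {t ε C Ψ : ℝ} (hε : 0 < ε) (hC : 0 ≤ C) (hΨ : 1 ≤ Ψ)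
    (h : t ^ 2 ≤ C * ε ^ 2 * Ψ) : t ≤ ε * (1 + C) * Ψ := by
  refine (abs_le_of_sq_le_sq' ?_ (by positivity)).2
  have h1 : C ≤ (1 + C) ^ 2 := by nlinarith
  have h2 : Ψ ≤ Ψ ^ 2 := by nlinarith
  calc t ^ 2 ≤ C * ε ^ 2 * Ψ := h
    _ ≤ (1 + C) ^ 2 * ε ^ 2 * Ψ ^ 2 := by gcongr
    _ = _ := by ring

theorem criticality_scale_le {t u L σ H ν ε C Ψ : ℝ} (hε : 0 < ε) (hε1 : ε ≤ 1) (hν : 0 < ν)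
    (hν' : ν ≤ 1) (hC : 0 ≤ C) (hL : 0 < L) (hLσ : L ≤ σ) (ht : 0 ≤ t) (hu : 0 ≤ u)
    (hΨ : 1 ≤ Ψ) (htΨ : t ≤ ε * (1 + C) * Ψ)
    (huΨ : 1 + σ / ε ^ (2 * ν) * (σ * u ^ 2) ≤ Ψ) :
    |H| * t ^ ν + L * t + (L + σ) * u ≤ (|H| * (2 + C) + L * (1 + C) + 1) * ε ^ ν * Ψ := by
  have hs : 0 < ε ^ ν := by positivity
  have hεν : ε ≤ ε ^ ν := by
    conv_lhs => rw [← Real.rpow_one ε]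
    exact Real.rpow_le_rpow_of_exponent_ge hε hε1 hν'
  have h1 : |H| * t ^ ν ≤ |H| * (2 + C) * ε ^ ν * Ψ := by
    have h2 : t / ε ≤ (1 + C) * Ψ := by
      rw [div_le_iff₀ hε]; linarith
    calc _ ≤ |H| * (ε ^ ν * (1 + t / ε)) := by
          gcongr; exact Real.rpow_le_rpow_mul_one_add_div ht hε hν hν'
      _ ≤ |H| * (ε ^ ν * (Ψ + (1 + C) * Ψ)) := by gcongr
      _ = _ := by ring
  have h2 : L * t ≤ L * (1 + C) * ε ^ ν * Ψ := by
    calc _ ≤ L * (ε ^ ν * (1 + C) * Ψ) := by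
          gcongr
          exact htΨ.trans (by gcongr)
      _ = _ := by ring
  have h3 : (L + σ) * u ≤ 1 * ε ^ ν * Ψ := by
    have h5 : ε ^ (2 * ν) = ε ^ ν * ε ^ ν := by rw [two_mul, Real.rpow_add hε]
    have h7 : σ / ε ^ (2 * ν) * (σ * u ^ 2) = (σ * u / ε ^ ν) ^ 2 := by
      rw [h5]; field_simp
    have h8 : 2 * (σ * u / ε ^ ν) ≤ Ψ := by
      refine le_trans ?_ huΨ
      rw [h7]
      nlinarith [sq_nonneg (σ * u / ε ^ ν - 1)]
    calc (L + σ) * u ≤ (2 * σ) * u := by gcongr; linarith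
      _ = ε ^ ν * (2 * (σ * u / ε ^ ν)) := by field_simp
      _ ≤ ε ^ ν * Ψ := by gcongr
      _ = _ := by ring
  linarith

/-- A single function Ψ = 1 + D + κσ‖x - z x‖² dominates both target quantities after scaling by ε
and ε^ν, and E Ψ(x_τ) is bounded uniformly in ε. -/
theorem convergence_of_stages {d : ℕ} {g h : Vec d → ℝ} {r : Vec d → EReal} {L H ν : ℝ}
    {x₁ : Vec d} (hL : 0 < L) (hν : 0 < ν) (hν' : ν ≤ 1)
    (hg : ConvexOn ℝ Set.univ g) (hgL : LSmooth L g)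
    (hh : ConvexOn ℝ Set.univ h) (hhH : HolderGradient H ν h)
    (hr : ProperLsc r) {m : ℕ} (hm : 1 ≤ m) (henv : EnvBounds g h r x₁ m)
    {γ α a b e B : ℝ} (hγ : 0 < γ) (hα : 1 ≤ α) (ha : 0 < a) (hab : a ≤ b) (he : m + 2 * ν ≤ e)
    (hB : 0 ≤ B) :
    ∃ C ε₀ : ℝ, 0 < C ∧ 0 < ε₀ ∧ ∀ (Ω : Type u) [MeasurableSpace Ω] (P : Measure Ω)
      [IsProbabilityMeasure P] (X : ℕ → Ω → Vec d) (ε : ℝ) (K : ℕ) (p z : Vec d → Vec d)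
      (τ : Ω → ℕ), 0 < ε → ε ≤ ε₀ → a * ε ^ (-e) ≤ (K : ℝ) → (K : ℝ) ≤ b * ε ^ (-e) →
      Measurable p → (∀ x, p x ∈ proxSet r (ε ^ m) x) →
      Measurable z → IsStageMin g h (ε ^ m) γ p z →
      (∀ k, Measurable (X k)) → (X 1 = fun _ => x₁) →
      (∀ k, 1 ≤ k → (k = 1 ∧ X 2 = X 1) ∨
        ∫⁻ ω, ‖X (k + 1) ω - z (X k ω)‖ₑ ^ 2 ∂P
          ≤ 4⁻¹ * ∫⁻ ω, ‖X k ω - z (X k ω)‖ₑ ^ 2 ∂P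
            + ENNReal.ofReal (B / ((1 / ε ^ m + γ) ^ 2 * k))) →
      IsStageIndex P K α τ → (∀ k, 1 ≤ k → IndepFun τ (X k) P) →
      ∫⁻ ω, edist (X (τ ω) ω) (p (X (τ ω) ω)) ∂P ≤ ENNReal.ofReal (C * ε) ∧
      upperExp P (fun ω => criticality g h r (p (X (τ ω) ω))) ≤ ENNReal.ofReal (C * ε ^ ν) := by
  obtain ⟨C₁, ε₁, hC₁, hε₁, henv⟩ := henv
  have hb : 0 < b := ha.trans_le hab
  have he0 : 0 ≤ e := le_trans (by positivity) he
  set M := 3 / 2 * C₁ + B * (1 + |Real.log b| + e) with hM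
  have hM0 : 0 ≤ M := by positivity
  set C₂ := 1 + M + 2 ^ α * ((1 + γ) / a) * (4 * M) with hC₂
  have hC₂0 : 0 < C₂ := by positivity
  set C₃ := |H| * (2 + C₁) + L * (1 + C₁) + 1 with hC₃
  have hC₃0 : 0 < C₃ := by positivity
  refine ⟨((1 + C₁) + C₃) * C₂, min ε₁ (min 1 (1 / (2 * L))), by positivity, by positivity, ?_⟩
  intro Ω _ P _ X ε K p z τ hε hε₀ hKa hKb hpm hp hzm hz hX hX1 hstage hτ hind
  have hεle : ε ≤ ε₁ := hε₀.trans (min_le_left _ _)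
  have hε1 : ε ≤ 1 := hε₀.trans ((min_le_right _ _).trans (min_le_left _ _))
  have hεL : ε ≤ 1 / (2 * L) := hε₀.trans ((min_le_right _ _).trans (min_le_right _ _))
  have hμ : 0 < ε ^ m := by positivity
  have hμε : ε ^ m ≤ ε := by
    simpa using pow_le_pow_of_le_one hε.le hε1 hm
  set σ := 1 / ε ^ m + γ with hσdef
  have hσ0 : 0 < σ := by positivity
  have hσε : 1 / ε ≤ σ := by
    have : 1 / ε ≤ 1 / ε ^ m := one_div_le_one_div_of_le hμ hμε
    linarith
  have hσL : 2 * L ≤ σ := by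
    refine le_trans ?_ hσε
    rw [le_div_iff₀ hε]
    rw [le_div_iff₀ (by positivity)] at hεL
    linarith
  have hK : 0 < K := by
    have h1 : 0 < (K : ℝ) := lt_of_lt_of_le (by positivity) hKa
    exact_mod_cast h1
  have hK0 : (0 : ℝ) < K := by exact_mod_cast hK
  obtain ⟨ℓ, hℓ₁, hℓ⟩ := henv ε p hε hεle hp
  set D : Vec d → ℝ := fun x => envObj g h r (ε ^ m) p x - ℓ with hD
  have hD0 : ∀ x, 0 ≤ D x := fun x => sub_nonneg.2 (hℓ x).1
  have hDm : Measurable D := (measurable_envObj hgL.1.continuous.measurable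
    hhH.1.continuous.measurable hr hpm).sub measurable_const
  have hdesc : ∀ x y, D y + σ / 2 * ‖x - z x‖ ^ 2 ≤ D x + σ * ‖y - z x‖ ^ 2 := fun x y => by
    have := envObj_add_le hg hgL hh hhH.1 hr hp hγ hσL hz x y
    simp only [hD]
    linarith
  -- Normalized so that κσ‖x - z x‖² = (σ‖x - z x‖/ε^ν)²; then 2s ≤ 1 + s² handles the term σ‖x - z
  -- x‖.
  set κ := σ / ε ^ (2 * ν) with hκ
  have hκ0 : 0 ≤ κ := by positivity
  have hMbound : 3 / 2 * D x₁ + B / σ * (1 + Real.log K) ≤ M := by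
    have h1 : B / σ * (1 + Real.log K) ≤ B * (1 + |Real.log b| + e) := by
      have h2 : 1 / σ ≤ ε := by
        rw [div_le_iff₀ hσ0]; rw [div_le_iff₀ hε] at hσε; linarith
      have h3 : 0 ≤ 1 + Real.log K := by have := Real.log_natCast_nonneg K; linarith
      calc B / σ * (1 + Real.log K) = B * (1 / σ * (1 + Real.log K)) := by ring
        _ ≤ B * (ε * (1 + Real.log K)) := by gcongr
        _ ≤ _ := by gcongr; exact mul_one_add_log_le hK hε hε1 hb he0 hKb
    have h2 : D x₁ ≤ C₁ := hℓ₁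
    linarith
  have hmain := lintegral_stageIndex_le hD0 hDm hzm hσ0 hB hdesc hX hX1 hstage hK hα hτ hind hκ0
    hMbound
  -- The only use of e ≥ m + 2ν: σ ε^m ≤ 1 + γ and K ε^e ≥ a bound κ/K = σ/(ε^(2ν) K).
  have hκK : κ * (2 ^ α / K) ≤ 2 ^ α * ((1 + γ) / a) := by
    have h1 : κ / K ≤ (1 + γ) / a := by
      rw [hκ, div_div, div_le_div_iff₀ (by positivity) ha]
      have h2 : σ * ε ^ m ≤ 1 + γ := by
        rw [hσdef, add_mul, one_div, inv_mul_cancel₀ hμ.ne']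
        nlinarith [hμε.trans hε1]
      have h3 : a ≤ K * ε ^ e := by
        have h4 := mul_le_mul_of_nonneg_right hKa (Real.rpow_nonneg hε.le e)
        rwa [mul_assoc, ← Real.rpow_add hε, neg_add_cancel, Real.rpow_zero, mul_one] at h4
      have h4 : ε ^ e ≤ ε ^ m * ε ^ (2 * ν) := by
        rw [← Real.rpow_natCast, ← Real.rpow_add hε]
        exact Real.rpow_le_rpow_of_exponent_ge hε hε1 he
      calc σ * a ≤ σ * (K * (ε ^ m * ε ^ (2 * ν))) := by
            gcongr; exact h3.trans (by gcongr)
        _ = σ * ε ^ m * (ε ^ (2 * ν) * K) := by ring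
        _ ≤ _ := by gcongr
    calc κ * (2 ^ α / K) = 2 ^ α * (κ / K) := by ring
      _ ≤ _ := by gcongr
  set Ψ : Vec d → ℝ := fun x => 1 + D x + κ * (σ * ‖x - z x‖ ^ 2) with hΨ
  have hΨm : Measurable Ψ := (measurable_const.add hDm).add
    ((((measurable_id.sub hzm).norm.pow_const 2).const_mul σ).const_mul κ)
  have hΨ0 : ∀ x, 0 ≤ Ψ x := fun x => by have := hD0 x; positivity
  have hXτ : Measurable fun ω => X (τ ω) ω := by
    have h1 : Measurable (Function.uncurry fun (k : ℕ) ω => X k ω) :=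
      measurable_from_prod_countable_right fun k => hX k
    exact h1.comp (hτ.1.prodMk measurable_id)
  have hmain' : ∫⁻ ω, ENNReal.ofReal (Ψ (X (τ ω) ω)) ∂P ≤ ENNReal.ofReal C₂ := by
    refine hmain.trans (ENNReal.ofReal_le_ofReal ?_)
    rw [hC₂]
    gcongr
  have hΨX : Measurable fun ω => ENNReal.ofReal (Ψ (X (τ ω) ω)) := (hΨm.comp hXτ).ennreal_ofReal
  have hscale : ∀ c : ℝ, 0 ≤ c → ∫⁻ ω, ENNReal.ofReal (c * Ψ (X (τ ω) ω)) ∂P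
      ≤ ENNReal.ofReal (c * C₂) := fun c hc => by
    rw [ENNReal.ofReal_mul hc]
    refine le_trans (le_of_eq ?_) (mul_le_mul_right hmain' _)
    rw [← lintegral_const_mul _ hΨX]
    simp only [ENNReal.ofReal_mul hc]
  have hΨ1 : ∀ x, 1 + D x ≤ Ψ x := fun x => le_add_of_nonneg_right (by positivity)
  have hΨ2 : ∀ x, 1 ≤ Ψ x := fun x => (le_add_of_nonneg_right (hD0 x)).trans (hΨ1 x)
  have hdist : ∀ x, ‖x - p x‖ ≤ ε * (1 + C₁) * Ψ x := fun x =>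
    le_mul_of_sq_le_mul hε hC₁.le (hΨ2 x) ((hℓ x).2.trans
      (mul_le_mul_of_nonneg_left (hΨ1 x) (by positivity)))
  have hcrit : ∀ x, criticality g h r (p x) ≤ ENNReal.ofReal (C₃ * ε ^ ν * Ψ x) := fun x => by
    refine (criticality_le hgL hL hhH hr hμ hγ hp hz x).trans (ENNReal.ofReal_le_ofReal ?_)
    refine criticality_scale_le hε hε1 hν hν' hC₁.le hL (by linarith) (norm_nonneg _)
      (norm_nonneg _) (hΨ2 x) (hdist x) ?_
    have h1 : Ψ x = 1 + D x + κ * (σ * ‖x - z x‖ ^ 2) := rfl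
    have h2 := hD0 x
    rw [h1]
    linarith
  constructor
  · calc ∫⁻ ω, edist (X (τ ω) ω) (p (X (τ ω) ω)) ∂P
        ≤ ∫⁻ ω, ENNReal.ofReal (ε * (1 + C₁) * Ψ (X (τ ω) ω)) ∂P := lintegral_mono fun ω => by
          rw [edist_dist, dist_eq_norm]
          exact ENNReal.ofReal_le_ofReal (hdist _)
      _ ≤ ENNReal.ofReal (ε * (1 + C₁) * C₂) := hscale _ (by positivity)
      _ ≤ _ := ENNReal.ofReal_le_ofReal (by
          have : 0 ≤ C₃ * C₂ * ε := by positivity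
          linarith)
  -- The measurable majorant C₃ ε^ν Ψ is a competitor in the infimum defining `upperExp`.
  · refine (iInf₂_le (fun ω => ENNReal.ofReal (C₃ * ε ^ ν * Ψ (X (τ ω) ω)))
      ⟨((hΨm.comp hXτ).const_mul _).ennreal_ofReal, fun ω => hcrit _⟩).trans ?_
    refine (hscale _ (by positivity)).trans (ENNReal.ofReal_le_ofReal ?_)
    have : 0 ≤ (1 + C₁) * C₂ * ε ^ ν := by positivity
    linarith

/-! ### The SVRG stages -/

/-- Error recursion common to SPG and SVRG: stationarity of `z` is subtracted from the explicit
step, so only the gradient error `v - w` remains. -/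
theorem smul_add_sub_proxStep {d : ℕ} {β σ γ : ℝ} (hs : 0 < β + σ) {y z x x₁ v c w : Vec d}
    (hy : y = (β + σ)⁻¹ • (β • x + γ • x₁ - (v - c))) (hz : w + σ • z = c + γ • x₁) :
    (β + σ) • (y - z) = β • (x - z) - (v - w) := by
  have h1 : (β + σ) • y = β • x + γ • x₁ - (v - c) := by
    rw [hy, smul_smul, mul_inv_cancel₀ hs.ne', one_smul]
  rw [smul_sub, h1]
  rw [← sub_eq_zero] at hz ⊢
  rw [← neg_eq_zero, ← hz]
  module

section SVRG

variable {d n : ℕ} {gs : Fin n → Vec d → ℝ} {g h : Vec d → ℝ} {L μ γ η : ℝ} {c z x₁ : Vec d}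

theorem svrgInner_succ (hη : 0 < 1 / η + (1 / μ + γ)) (xbar : Vec d) (i : ℕ → Fin n) (t : ℕ) :
    svrgInner gs g c (quadReg μ) γ η x₁ xbar i (t + 1) = (1 / η + (1 / μ + γ))⁻¹ •
      ((1 / η) • svrgInner gs g c (quadReg μ) γ η x₁ xbar i t + γ • x₁
        - (gradient (gs (i (t + 1))) (svrgInner gs g c (quadReg μ) γ η x₁ xbar i t)
          - gradient (gs (i (t + 1))) xbar + gradient g xbar - c)) := by
  rw [svrgInner]
  set x := svrgInner gs g c (quadReg μ) γ η x₁ xbar i t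
  rw [← add_sub_assoc (gradient (gs (i (t + 1))) x - gradient (gs (i (t + 1))) xbar)]
  set v := gradient (gs (i (t + 1))) x - gradient (gs (i (t + 1))) xbar + gradient g xbar - c
  refine argmin_proxStep (κ := - inner ℝ x v) v x x₁ hη fun y => ?_
  rw [inner_sub_right, real_inner_comm v y, real_inner_comm v x, quadReg]
  simp only [one_div, mul_inv]
  ring

/-- While an iterate is no farther from `z` than `xbar`, the Lipschitz bounds give (1/η + σ)‖y - z‖
≤ (1/η + 3L)‖xbar - z‖, and σ ≥ 1/η + 6L makes the ratio at most 1/2. The argument is pathwise, for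
any indices. -/
theorem norm_svrgInner_sub_le (hgs : ∀ j, LSmooth L (gs j)) (hgL : LSmooth L g) (hL : 0 < L)
    (hη : 0 < η) (hσ : 1 / η + 6 * L ≤ 1 / μ + γ)
    (hz : gradient g z + (1 / μ + γ) • z = c + γ • x₁) (xbar : Vec d) (i : ℕ → Fin n) (t : ℕ) :
    ‖svrgInner gs g c (quadReg μ) γ η x₁ xbar i (t + 1) - z‖ ≤ 1 / 2 * ‖xbar - z‖ := by
  have hη' : 0 < 1 / η := by positivity
  set σ := 1 / μ + γ with hσdef
  have hs : 0 < 1 / η + σ := by linarith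
  have key : ∀ t, ‖svrgInner gs g c (quadReg μ) γ η x₁ xbar i t - z‖ ≤ ‖xbar - z‖ →
      ‖svrgInner gs g c (quadReg μ) γ η x₁ xbar i (t + 1) - z‖ ≤ 1 / 2 * ‖xbar - z‖ := by
    intro t ht
    have h1 := smul_add_sub_proxStep hs (svrgInner_succ (gs := gs) (g := g) (c := c) (x₁ := x₁)
      hs xbar i t) hz
    set x := svrgInner gs g c (quadReg μ) γ η x₁ xbar i t
    set y := svrgInner gs g c (quadReg μ) γ η x₁ xbar i (t + 1)
    have h2 : (1 / η + σ) * ‖y - z‖ ≤ 1 / η * ‖x - z‖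
        + (L * ‖x - xbar‖ + L * ‖xbar - z‖) := by
      have := congrArg norm h1
      rw [norm_smul, Real.norm_of_nonneg hs.le] at this
      rw [this]
      refine (norm_sub_le _ _).trans ?_
      rw [norm_smul, Real.norm_of_nonneg hη'.le, add_sub_assoc]
      gcongr
      exact (norm_add_le _ _).trans (add_le_add ((hgs _).2 _ _) (hgL.2 _ _))
    have h3 : ‖x - xbar‖ ≤ ‖x - z‖ + ‖xbar - z‖ := by
      rw [norm_sub_rev xbar z]; exact norm_sub_le_norm_sub_add_norm_sub _ _ _
    have h4 : (1 / η + σ) * ‖y - z‖ ≤ (1 / η + 3 * L) * ‖xbar - z‖ := by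
      calc _ ≤ 1 / η * ‖xbar - z‖ + (L * (‖xbar - z‖ + ‖xbar - z‖) + L * ‖xbar - z‖) := by
            refine h2.trans ?_
            gcongr
            exact h3.trans (by gcongr)
        _ = _ := by ring
    have h5 : (1 / η + 3 * L) * ‖xbar - z‖ ≤ (1 / η + σ) * (1 / 2 * ‖xbar - z‖) := by
      nlinarith [norm_nonneg (xbar - z)]
    exact le_of_mul_le_mul_left (h4.trans h5) hs
  have hle : ∀ t, ‖svrgInner gs g c (quadReg μ) γ η x₁ xbar i t - z‖ ≤ ‖xbar - z‖ := by
    intro t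
    induction t with
    | zero => exact le_rfl
    | succ t ih => exact (key t ih).trans (by linarith [norm_nonneg (xbar - z)])
  exact key t (hle t)

/-- Averaging preserves the halving, and one epoch already suffices; further epochs only shrink the
distance. -/
theorem norm_svrg_sub_le (hgs : ∀ j, LSmooth L (gs j)) (hgL : LSmooth L g) (hL : 0 < L)
    (hη : 0 < η) (hσ : 1 / η + 6 * L ≤ 1 / μ + γ)
    (hz : gradient g z + (1 / μ + γ) • z = c + γ • x₁) {T : ℕ} (hT : 0 < T)
    (i : ℕ → ℕ → Fin n) {S : ℕ} (hS : 0 < S) :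
    ‖svrg gs g c (quadReg μ) γ η x₁ T i S - z‖ ≤ 1 / 2 * ‖x₁ - z‖ := by
  have hT0 : (0 : ℝ) < T := by exact_mod_cast hT
  have key : ∀ s, ‖svrg gs g c (quadReg μ) γ η x₁ T i (s + 1) - z‖
      ≤ 1 / 2 * ‖svrg gs g c (quadReg μ) γ η x₁ T i s - z‖ := fun s => by
    rw [svrg]
    set xbar := svrg gs g c (quadReg μ) γ η x₁ T i s
    set y := svrgInner gs g c (quadReg μ) γ η x₁ xbar (i (s + 1))
    have h1 : (T : ℝ)⁻¹ • ∑ t ∈ Finset.Icc 1 T, y t - z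
        = (T : ℝ)⁻¹ • ∑ t ∈ Finset.Icc 1 T, (y t - z) := by
      rw [Finset.sum_sub_distrib, smul_sub, Finset.sum_const, Nat.card_Icc, Nat.add_sub_cancel,
        ← Nat.cast_smul_eq_nsmul ℝ, smul_smul, inv_mul_cancel₀ hT0.ne', one_smul]
    rw [h1, norm_smul, Real.norm_of_nonneg (by positivity), inv_mul_le_iff₀ hT0]
    calc ‖∑ t ∈ Finset.Icc 1 T, (y t - z)‖ ≤ ∑ t ∈ Finset.Icc 1 T, ‖y t - z‖ := norm_sum_le _ _
      _ ≤ ∑ t ∈ Finset.Icc 1 T, 1 / 2 * ‖xbar - z‖ := Finset.sum_le_sum fun t ht => by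
          obtain ⟨t, rfl⟩ : ∃ t', t = t' + 1 := ⟨t - 1, by have := (Finset.mem_Icc.1 ht).1; omega⟩
          exact norm_svrgInner_sub_le hgs hgL hL hη hσ hz xbar _ t
      _ = _ := by simp
  obtain ⟨s, rfl⟩ : ∃ s, S = s + 1 := ⟨S - 1, by omega⟩
  clear hS
  induction s with
  | zero => exact key 0
  | succ s ih => exact (key (s + 1)).trans (by linarith [norm_nonneg (x₁ - z)])

variable {p : Vec d → Vec d} {T S : ℕ → ℕ}

theorem ssdcSVRG_succ {k : ℕ} (hk : 1 ≤ k) (i : ℕ × ℕ × ℕ → Fin n) :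
    ssdcSVRG gs g h p μ γ η T S x₁ i (k + 1)
      = svrg gs g (gradient h (ssdcSVRG gs g h p μ γ η T S x₁ i k)
          + (1 / μ) • p (ssdcSVRG gs g h p μ γ η T S x₁ i k)) (quadReg μ) γ η
          (ssdcSVRG gs g h p μ γ η T S x₁ i k) (T k) (fun s t => i (k, s, t)) (S k) := by
  rw [ssdcSVRG, iterFromOne, if_neg (by omega)]

theorem measurable_svrgInner (hη : 0 < 1 / η + (1 / μ + γ)) {Ω : Type*} [MeasurableSpace Ω]
    {c x xbar : Ω → Vec d} (hc : Measurable c) (hx : Measurable x) (hxbar : Measurable xbar)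
    {i : ℕ → Ω → Fin n} (hi : ∀ t, Measurable (i t)) (t : ℕ) :
    Measurable fun ω =>
      svrgInner gs g (c ω) (quadReg μ) γ η (x ω) (xbar ω) (fun t => i t ω) t := by
  have hgs : Measurable fun q : Fin n × Vec d => gradient (gs q.1) q.2 :=
    measurable_from_prod_countable_right fun j => measurable_gradient (gs j)
  have hcomp : ∀ {y : Ω → Vec d}, Measurable y → ∀ t,
      Measurable fun ω => gradient (gs (i t ω)) (y ω) := fun hy t => hgs.comp ((hi t).prodMk hy)
  induction t with
  | zero => exact hxbar
  | succ t ih =>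
    simp only [svrgInner_succ hη]
    exact (((ih.fun_const_smul (1 / η)).add (hx.fun_const_smul γ)).sub
      ((((hcomp ih (t + 1)).sub (hcomp hxbar (t + 1))).add
        ((measurable_gradient g).comp hxbar)).sub hc)).fun_const_smul _

theorem measurable_ssdcSVRG (hη : 0 < 1 / η + (1 / μ + γ)) (hp : Measurable p) {Ω : Type*}
    [MeasurableSpace Ω] {i : ℕ × ℕ × ℕ → Ω → Fin n} (hi : ∀ j, Measurable (i j)) (k : ℕ) :
    Measurable fun ω => ssdcSVRG gs g h p μ γ η T S x₁ (fun j => i j ω) k := by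
  induction k with
  | zero => exact measurable_const
  | succ k ih =>
    rcases Nat.eq_zero_or_pos k with rfl | hk
    · exact measurable_const
    simp only [ssdcSVRG_succ hk]
    set x := fun ω => ssdcSVRG gs g h p μ γ η T S x₁ (fun j => i j ω) k
    have hc : Measurable fun ω => gradient h (x ω) + (1 / μ) • p (x ω) :=
      ((measurable_gradient h).comp ih).add ((hp.comp ih).const_smul (1 / μ))
    change Measurable fun ω => svrg gs g (gradient h (x ω) + (1 / μ) • p (x ω)) (quadReg μ) γ η
      (x ω) (T k) (fun s t => i (k, s, t) ω) (S k)
    induction S k with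
    | zero => exact ih
    | succ s ihs =>
      simp only [svrg]
      apply Measurable.fun_const_smul
      apply Finset.measurable_fun_sum
      rintro t -
      exact measurable_svrgInner hη hc ih ihs (i := fun t => i (k, s + 1, t))
        (fun t => hi (k, s + 1, t)) t

end SVRG

/-! ### Convergence of SSDC with SVRG -/

theorem pow_small_bound {ε c : ℝ} {m : ℕ} (hm : 1 ≤ m) (hε : 0 < ε) (hc : 0 < c)
    (h : ε ≤ min 1 (1 / c)) : c ≤ 1 / ε ^ m := by
  have h1 : ε ≤ 1 := h.trans (min_le_left _ _)
  have h2 : ε ≤ 1 / c := h.trans (min_le_right _ _)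
  have h3 : ε ^ m ≤ ε := by simpa using pow_le_pow_of_le_one hε.le h1 hm
  rw [le_div_iff₀ (by positivity)]
  rw [le_div_iff₀ hc] at h2
  nlinarith

theorem svrgConvergence_of_envBounds {d n : ℕ} {gs : Fin n → Vec d → ℝ} {g h : Vec d → ℝ}
    {r : Vec d → EReal} {L H ν : ℝ} {x₁ : Vec d} (hL : 0 < L) (hν : 0 < ν) (hν' : ν ≤ 1)
    (hg : ConvexOn ℝ Set.univ g) (hgL : LSmooth L g)
    (hh : ConvexOn ℝ Set.univ h) (hhH : HolderGradient H ν h)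
    (hr : ProperLsc r) {m : ℕ} (hm : 1 ≤ m) (henv : EnvBounds g h r x₁ m)
    (hgs : ∀ j, LSmooth L (gs j))
    {γ α a b e : ℝ} (hγ : 0 < γ) (hα : 1 ≤ α) (ha : 0 < a) (hab : a ≤ b) (he : m + 2 * ν ≤ e) :
    SVRGConvergence.{u} gs g h r L ν γ α x₁ a b m e := by
  obtain ⟨C, ε₀, hC, hε₀, hconv⟩ := convergence_of_stages.{u} hL hν hν' hg hgL hh hhH hr hm henv
    hγ hα ha hab he le_rfl
  -- 26L = 20L + 6L with 1/η = 20L, the threshold for the halving.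
  refine ⟨C, min ε₀ (min 1 (1 / (26 * L))), hC, by positivity, ?_⟩
  intro Ω _ P _ i ε K T p τ hi _ _ hε hεle hKa hKb hT hpm hp hτ hind
  have hε₁ : ε ≤ ε₀ := hεle.trans (min_le_left _ _)
  have hμ : 26 * L ≤ 1 / ε ^ m :=
    pow_small_bound hm hε (by positivity) (hεle.trans (min_le_right _ _))
  have hη : 1 / (0.05 / L) = 20 * L := by field_simp; norm_num
  have hη0 : 0 < 1 / (0.05 / L) + (1 / ε ^ m + γ) := by positivity
  obtain ⟨z, hzm, hz⟩ := exists_measurable_isStageMin (μ := ε ^ m) (γ := γ) h hgL hL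
    (by linarith) hpm
  refine hconv Ω P (fun k ω => ssdcSVRG gs g h p (ε ^ m) γ (0.05 / L) T (Nat.clog 2) x₁
    (fun j => i j ω) k) ε K p z τ hε hε₁ hKa hKb hpm hp hzm hz
    (measurable_ssdcSVRG hη0 hpm hi) rfl (fun k hk => ?_) hτ (fun k _ => ?_)
  · rcases hk.eq_or_lt with rfl | hk1
    · refine Or.inl ⟨rfl, funext fun ω => ?_⟩
      rw [ssdcSVRG_succ le_rfl, Nat.clog_one_right, svrg]
    · right
      -- For k ≥ 2 there is at least one epoch, so the squared distance drops by 1/4 with no noise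
      -- term (B = 0).
      refine le_trans ?_ le_self_add
      have hX := measurable_ssdcSVRG (gs := gs) (g := g) (h := h) (T := T) (S := Nat.clog 2)
        (x₁ := x₁) hη0 hpm hi k
      have hmeas : Measurable fun ω => ‖ssdcSVRG gs g h p (ε ^ m) γ (0.05 / L) T (Nat.clog 2) x₁
          (fun j => i j ω) k - z (ssdcSVRG gs g h p (ε ^ m) γ (0.05 / L) T (Nat.clog 2) x₁
          (fun j => i j ω) k)‖ₑ ^ 2 := (hX.sub (hzm.comp hX)).enorm.pow_const 2
      rw [← lintegral_const_mul _ hmeas]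
      refine lintegral_mono fun ω => ?_
      have hTk : 0 < T k := by
        have := (le_max_left _ _).trans (hT k hk)
        have h0 : (0 : ℝ) < T k := by linarith
        exact_mod_cast h0
      simp only [ssdcSVRG_succ hk]
      set x := ssdcSVRG gs g h p (ε ^ m) γ (0.05 / L) T (Nat.clog 2) x₁ (fun j => i j ω) k
      have h1 := norm_svrg_sub_le (η := 0.05 / L) hgs hgL hL (by positivity) (by rw [hη]; linarith) (hz x) hTk
        (fun s t => i (k, s, t) ω) (Nat.clog_pos (b := 2) (by norm_num) hk1)
      set y := svrg gs g (gradient h x + (1 / ε ^ m) • p x) (quadReg (ε ^ m)) γ (0.05 / L) x (T k)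
        (fun s t => i (k, s, t) ω) (Nat.clog 2 k)
      have e4 : (4 : ℝ≥0∞)⁻¹ * ‖x - z x‖ₑ ^ 2 = ENNReal.ofReal (4⁻¹ * ‖x - z x‖ ^ 2) := by
        rw [ENNReal.ofReal_mul (by norm_num), ENNReal.ofReal_inv_of_pos (by norm_num),
          ENNReal.ofReal_ofNat, ENNReal.ofReal_pow (norm_nonneg _), ofReal_norm]
      rw [e4, ← ofReal_norm, ← ENNReal.ofReal_pow (norm_nonneg _)]
      apply ENNReal.ofReal_le_ofReal
      nlinarith [norm_nonneg (y - z x), norm_nonneg (x - z x)]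
  · have h1 : Measurable fun j : ℕ × ℕ × ℕ → Fin n =>
        ssdcSVRG gs g h p (ε ^ m) γ (0.05 / L) T (Nat.clog 2) x₁ j k :=
      measurable_ssdcSVRG hη0 hpm (fun j => measurable_pi_apply j) k
    exact hind.comp measurable_id h1

/-! ### Upper bounds on expectations -/

/-- `a ≥ 0` bounds the expectation of the measurable function `f` (of its positive part). -/
def ExpLE {Ω : Type*} [MeasurableSpace Ω] (P : Measure Ω) (f : Ω → ℝ) (a : ℝ) : Prop :=
  Measurable f ∧ 0 ≤ a ∧ ∫⁻ ω, ENNReal.ofReal (f ω) ∂P ≤ ENNReal.ofReal a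

section ExpLE

variable {Ω : Type*} [MeasurableSpace Ω] {P : Measure Ω}

theorem ExpLE.zero : ExpLE P (fun _ => 0) 0 := ⟨measurable_const, le_rfl, by simp⟩

theorem ExpLE.add {f f' : Ω → ℝ} {a b : ℝ} (hf : ExpLE P f a) (hf' : ExpLE P f' b) :
    ExpLE P (fun ω => f ω + f' ω) (a + b) := by
  refine ⟨hf.1.add hf'.1, add_nonneg hf.2.1 hf'.2.1, ?_⟩
  rw [ENNReal.ofReal_add hf.2.1 hf'.2.1]
  refine (lintegral_mono fun ω => ENNReal.ofReal_add_le).trans ?_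
  rw [lintegral_add_left hf.1.ennreal_ofReal]
  exact add_le_add hf.2.2 hf'.2.2

theorem ExpLE.const_mul {f : Ω → ℝ} {a c : ℝ} (hc : 0 ≤ c) (hf : ExpLE P f a) :
    ExpLE P (fun ω => c * f ω) (c * a) := by
  refine ⟨hf.1.const_mul c, mul_nonneg hc hf.2.1, ?_⟩
  simp only [ENNReal.ofReal_mul hc]
  rw [lintegral_const_mul _ hf.1.ennreal_ofReal]
  exact mul_le_mul_right hf.2.2 _

theorem ExpLE.sum {ι : Type*} {s : Finset ι} {f : ι → Ω → ℝ} {a : ι → ℝ}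
    (h : ∀ i ∈ s, ExpLE P (f i) (a i)) : ExpLE P (fun ω => ∑ i ∈ s, f i ω) (∑ i ∈ s, a i) := by
  classical
  induction s using Finset.induction_on with
  | empty => simpa using ExpLE.zero
  | insert i s hi ih =>
    simp only [Finset.sum_insert hi]
    exact (h i (Finset.mem_insert_self i s)).add
      (ih fun j hj => h j (Finset.mem_insert_of_mem hj))

theorem ExpLE.mono {f f' : Ω → ℝ} {a b : ℝ} (hf : ExpLE P f a) (hf' : Measurable f')
    (h : ∀ ω, f' ω ≤ f ω) (hab : a ≤ b) : ExpLE P f' b :=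
  ⟨hf', hf.2.1.trans hab, (lintegral_mono fun ω => ENNReal.ofReal_le_ofReal (h ω)).trans
    (hf.2.2.trans (ENNReal.ofReal_le_ofReal hab))⟩

end ExpLE

/-! ### Independent centered noise -/

theorem lintegral_norm_add_sq_le {d : ℕ} {S : Type*} [MeasurableSpace S] {ν : Measure S}
    [IsProbabilityMeasure ν] {n : S → Vec d} {V c : ℝ} (hV : 0 ≤ V) (hn : Integrable n ν)
    (hmean : ∫ u, n u ∂ν = 0) (hvar : ∫⁻ u, ‖n u‖ₑ ^ 2 ∂ν ≤ ENNReal.ofReal V) (y : Vec d) :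
    ∫⁻ u, ENNReal.ofReal (‖y + c • n u‖ ^ 2) ∂ν ≤ ENNReal.ofReal (‖y‖ ^ 2 + c ^ 2 * V) := by
  have hsq : Integrable (fun u => ‖n u‖ ^ 2) ν := by
    refine ⟨(hn.1.norm.pow 2), ?_⟩
    refine lt_of_le_of_lt ?_ (hvar.trans_lt ENNReal.ofReal_lt_top)
    refine lintegral_mono fun u => ?_
    simp [enorm_pow]
  have hint : ∫ u, ‖n u‖ ^ 2 ∂ν ≤ V := by
    rw [integral_eq_lintegral_of_nonneg_ae (Filter.Eventually.of_forall fun u => by positivity)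
      hsq.1]
    refine ENNReal.toReal_le_of_le_ofReal hV (le_trans (le_of_eq ?_) hvar)
    refine lintegral_congr fun u => ?_
    rw [ENNReal.ofReal_pow (norm_nonneg _), ofReal_norm]
  have e : ∀ u, ‖y + c • n u‖ ^ 2 = ‖y‖ ^ 2 + 2 * c * inner ℝ y (n u) + c ^ 2 * ‖n u‖ ^ 2 := by
    intro u
    rw [norm_add_sq_real, inner_smul_right, norm_smul, mul_pow, Real.norm_eq_abs, sq_abs]
    ring
  have hin : Integrable (fun u => inner ℝ y (n u)) ν := hn.const_inner y
  have hi2 : Integrable (fun u => ‖y‖ ^ 2 + 2 * c * inner ℝ y (n u)) ν :=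
    (integrable_const _).add (hin.const_mul _)
  rw [← ofReal_integral_eq_lintegral_ofReal]
  · apply ENNReal.ofReal_le_ofReal
    simp only [e]
    rw [integral_add hi2 (hsq.const_mul _), integral_add (integrable_const _) (hin.const_mul _),
      integral_const_mul, integral_const_mul, integral_inner hn, hmean]
    simp only [integral_const, probReal_univ, inner_zero_right]
    simp only [one_smul, mul_zero, add_zero]
    gcongr
  · simp only [e]
    exact hi2.add (hsq.const_mul _)
  · exact Filter.Eventually.of_forall fun u => by positivity

/-- `X` and `Y` depend on the past only, so they can be frozen by Fubini; for fixed values the cross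
term with the centered noise vanishes. -/
theorem ExpLE.norm_add_noise_sq {d : ℕ} {Ω S V : Type*} [MeasurableSpace S] [MeasurableSpace V]
    {m mΩ : MeasurableSpace Ω} {P : Measure Ω} [IsProbabilityMeasure P]
    (hm : m ≤ mΩ) {s : Ω → S} (hs : Measurable s)
    (hind : Indep m (MeasurableSpace.comap s inferInstance) P) {ν : Measure S}
    [IsProbabilityMeasure ν] (hν : P.map s = ν) {N : V → S → Vec d} {G : ℝ}
    (hG : 0 ≤ G) (hN : Measurable (Function.uncurry N)) (hint : ∀ x, Integrable (N x) ν)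
    (hmean : ∀ x, ∫ u, N x u ∂ν = 0)
    (hvar : ∀ x, ∫⁻ u, ‖N x u‖ₑ ^ 2 ∂ν ≤ ENNReal.ofReal G)
    {X : Ω → V} (hX : Measurable[m] X) {Y : Ω → Vec d} (hY : Measurable[m] Y) (c : ℝ) {a : ℝ}
    (ha : ExpLE P (fun ω => ‖Y ω‖ ^ 2) a) :
    ExpLE P (fun ω => ‖Y ω + c • N (X ω) (s ω)‖ ^ 2) (a + c ^ 2 * G) := by
  have hX' : Measurable X := hX.mono hm le_rfl
  have hY' : Measurable Y := hY.mono hm le_rfl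
  have hXY : Measurable fun ω => (X ω, Y ω) := hX'.prodMk hY'
  have hpair : IndepFun (fun ω => (X ω, Y ω)) s P := by
    rw [IndepFun_iff_Indep]
    exact indep_of_indep_of_le_left hind ((hX.prodMk hY).comap_le)
  have hlaw := (indepFun_iff_map_prod_eq_prod_map_map hXY.aemeasurable hs.aemeasurable).1 hpair
  rw [hν] at hlaw
  have hN' : Measurable fun q : (V × Vec d) × S => N q.1.1 q.2 :=
    hN.comp (measurable_fst.fst.prodMk measurable_snd)
  have hadd : Measurable fun q : (V × Vec d) × S => q.1.2 + c • N q.1.1 q.2 :=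
    measurable_fst.snd.add (hN'.fun_const_smul c)
  have hmeas : Measurable fun q : (V × Vec d) × S => ENNReal.ofReal (‖q.1.2 + c • N q.1.1 q.2‖ ^ 2) :=
    (hadd.norm.pow_const 2).ennreal_ofReal
  have hmeas' : Measurable fun ω => ‖Y ω + c • N (X ω) (s ω)‖ ^ 2 :=
    (hY'.add ((hN.comp (hX'.prodMk hs)).fun_const_smul c)).norm.pow_const 2
  have hmeasY : Measurable fun q : V × Vec d => ENNReal.ofReal (‖q.2‖ ^ 2 + c ^ 2 * G) :=
    ((measurable_snd.norm.pow_const 2).add_const _).ennreal_ofReal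
  refine ⟨hmeas', by have := ha.2.1; positivity, ?_⟩
  have h1 := lintegral_map (μ := P) hmeas (hXY.prodMk hs)
  have h2 := lintegral_map (μ := P) hmeasY hXY
  have h3 : ∀ q : V × Vec d, ∫⁻ u, ENNReal.ofReal (‖q.2 + c • N q.1 u‖ ^ 2) ∂ν
      ≤ ENNReal.ofReal (‖q.2‖ ^ 2 + c ^ 2 * G) := fun q =>
    lintegral_norm_add_sq_le hG (hint q.1) (hmean q.1) (hvar q.1) q.2
  rw [← h1, hlaw, lintegral_prod _ hmeas.aemeasurable]
  refine (lintegral_mono h3).trans ?_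
  rw [h2]
  have hc : ExpLE P (fun _ : Ω => c ^ 2 * G) (c ^ 2 * G) :=
    ⟨measurable_const, by positivity, by simp⟩
  exact (ha.add hc).2.2

/-! ### One stage of the stochastic proximal gradient method -/

/-- The increase of β_t from one step to the next is beaten by σ, which leaves the surplus σ β_t U_t
to be summed. This bounds the last error and the weighted sum together. -/
theorem spg_potential {β₁ γ L σ V : ℝ} {U : ℕ → ℝ} (hβ₁ : β₁ = γ / 3) (hγ : 0 < γ) (hL : 0 < L)
    (hσ : 2 * (γ / 3 + L) ≤ σ) (hU : ∀ t, 0 ≤ U t)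
    (hrec : ∀ t, 1 ≤ t → (β₁ * (t + 1) + σ) ^ 2 * U (t + 1) = (β₁ * (t + 1) + L) ^ 2 * U t + V)
    {T : ℕ} (hT : 1 ≤ T) :
    (β₁ * (T + 1) + σ) ^ 2 * U (T + 1) + σ * ∑ t ∈ Finset.Icc 2 T, β₁ * (t + 1) * U t
      ≤ (2 * β₁ + L) ^ 2 * U 1 + T * V := by
  induction T, hT using Nat.le_induction with
  | base =>
    have := hrec 1 le_rfl
    norm_num at this ⊢
    rw [this, mul_comm β₁ 2]
  | succ T hT ih =>
    rw [Finset.sum_Icc_succ_top (by omega)]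
    have h1 := hrec (T + 1) (by omega)
    push_cast at h1 ⊢
    rw [h1]
    set b := β₁ * ((T : ℝ) + 1) with hb
    have hb0 : 0 ≤ b := by rw [hb, hβ₁]; positivity
    have e : β₁ * ((T : ℝ) + 1 + 1) = b + γ / 3 := by rw [hb, hβ₁]; ring
    rw [e]
    -- Expand: γ/3 + L ≤ σ/2 makes the terms linear in b at most 2bσ and the constant ones at most
    -- σ²/4 + σ²/2.
    have h2 : (b + γ / 3 + L) ^ 2 + σ * (b + γ / 3) ≤ (b + σ) ^ 2 := by
      have h3 : (γ / 3 + L) ^ 2 ≤ (σ / 2) ^ 2 := by gcongr; linarith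
      have h4 : σ * (γ / 3) ≤ σ * (σ / 2) := by
        exact mul_le_mul_of_nonneg_left (by linarith) (by linarith)
      nlinarith
    have h3 := mul_le_mul_of_nonneg_right h2 (hU (T + 1))
    linarith

/-- Multiply the recursion by t + 1 and sum. With 1/η_t = γ(t+1)/3 the coefficients (t+1)²γ/3 and
t²γ/3 of e_t nearly cancel, leaving (2t+1)γ/3. The noise stays inside a linear sum, where its
orthogonality can be used. -/
theorem spg_sum_identity {d : ℕ} {γ σ : ℝ} {e δ n : ℕ → Vec d}
    (hrec : ∀ t : ℕ, 1 ≤ t → (γ / 3 * (t + 1) + σ) • e (t + 1)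
      = (γ / 3 * (t + 1)) • e t - δ t - n t) {T : ℕ} (hT : 1 ≤ T) :
    σ • ∑ t ∈ Finset.Icc 2 (T + 1), (t : ℝ) • e t
      = (4 * γ / 3) • e 1 + ∑ t ∈ Finset.Icc 2 T, ((2 * t + 1) * γ / 3) • e t
        - ((T + 1) ^ 2 * γ / 3) • e (T + 1) - ∑ t ∈ Finset.Icc 1 T, ((t : ℝ) + 1) • δ t
        - ∑ t ∈ Finset.Icc 1 T, ((t : ℝ) + 1) • n t := by
  induction T, hT using Nat.le_induction with
  | base =>
    have h := hrec 1 le_rfl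
    norm_num at h ⊢
    rw [← sub_eq_zero] at h ⊢
    have h2 := congrArg (fun v => (2 : ℝ) • v) h
    simp only [smul_zero] at h2
    rw [← h2]
    module
  | succ T hT ih =>
    have h := hrec (T + 1) (by omega)
    rw [Finset.sum_Icc_succ_top (by omega), smul_add, ih, Finset.sum_Icc_succ_top (by omega),
      Finset.sum_Icc_succ_top (by omega), Finset.sum_Icc_succ_top (by omega)]
    push_cast at h ⊢
    rw [← sub_eq_zero] at h ⊢
    have h2 := congrArg (fun v => ((T : ℝ) + 1 + 1) • v) h
    simp only [smul_zero] at h2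
    rw [← h2]
    module

/-- For t ≥ 2, (2t+1)/3 ≤ t and t + 1 ≤ 2t merge the two error sums into γ + 2L times ∑ t‖e t‖, to
which Cauchy–Schwarz with weights t applies. -/
theorem norm_spg_sum_sq_le {d : ℕ} {γ σ L : ℝ} (hγ : 0 < γ) (hσ : 0 < σ) (hL : 0 < L)
    {e δ n : ℕ → Vec d} (hδ : ∀ t, ‖δ t‖ ≤ L * ‖e t‖)
    (hrec : ∀ t : ℕ, 1 ≤ t → (γ / 3 * (t + 1) + σ) • e (t + 1)
      = (γ / 3 * (t + 1)) • e t - δ t - n t) {T : ℕ} (hT : 1 ≤ T) :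
    σ ^ 2 * ‖∑ t ∈ Finset.Icc 2 (T + 1), (t : ℝ) • e t‖ ^ 2
      ≤ 4 * (4 * (γ + 2 * L) ^ 2 * ‖e 1‖ ^ 2
        + (γ + 2 * L) ^ 2 * (T * (T + 3) / 2) * ∑ t ∈ Finset.Icc 2 T, (t : ℝ) * ‖e t‖ ^ 2
        + ((T + 1) ^ 2 * γ / 3) ^ 2 * ‖e (T + 1)‖ ^ 2
        + ‖∑ t ∈ Finset.Icc 1 T, ((t : ℝ) + 1) • n t‖ ^ 2) := by
  have hid := congrArg norm (spg_sum_identity hrec hT)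
  rw [norm_smul, Real.norm_of_nonneg hσ.le] at hid
  set S := ∑ t ∈ Finset.Icc 2 (T + 1), (t : ℝ) • e t
  set N := ∑ t ∈ Finset.Icc 1 T, ((t : ℝ) + 1) • n t
  set c := γ + 2 * L with hc
  have hc0 : 0 < c := by positivity
  set R := ∑ t ∈ Finset.Icc 2 T, (t : ℝ) * ‖e t‖ with hR
  have hR0 : 0 ≤ R := Finset.sum_nonneg fun t _ => by positivity
  have hδsum : ‖∑ t ∈ Finset.Icc 1 T, ((t : ℝ) + 1) • δ t‖
      ≤ 2 * L * ‖e 1‖ + 2 * L * R := by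
    refine (norm_sum_le _ _).trans ?_
    rw [← Finset.add_sum_Ioc_eq_sum_Icc hT]
    have hI : Finset.Ioc 1 T = Finset.Icc 2 T := by ext; simp; omega
    rw [hI]
    refine add_le_add ?_ ?_
    · rw [norm_smul]
      have := hδ 1
      norm_num
      linarith
    · rw [hR, Finset.mul_sum]
      refine Finset.sum_le_sum fun t ht => ?_
      have ht2 : (2 : ℝ) ≤ t := by exact_mod_cast (Finset.mem_Icc.1 ht).1
      rw [norm_smul, Real.norm_of_nonneg (by positivity)]
      calc ((t : ℝ) + 1) * ‖δ t‖ ≤ (2 * t) * (L * ‖e t‖) := by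
            gcongr
            · linarith
            · exact hδ t
        _ = _ := by ring
  have hesum : ‖∑ t ∈ Finset.Icc 2 T, ((2 * (t : ℝ) + 1) * γ / 3) • e t‖ ≤ γ * R := by
    refine (norm_sum_le _ _).trans ?_
    rw [hR, Finset.mul_sum]
    refine Finset.sum_le_sum fun t ht => ?_
    have ht2 : (2 : ℝ) ≤ t := by exact_mod_cast (Finset.mem_Icc.1 ht).1
    rw [norm_smul, Real.norm_of_nonneg (by positivity), ← mul_assoc]
    gcongr
    nlinarith
  have hbound : σ * ‖S‖ ≤ 2 * c * ‖e 1‖ + c * R + (T + 1) ^ 2 * γ / 3 * ‖e (T + 1)‖ + ‖N‖ := by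
    rw [hid]
    refine (norm_sub_le _ _).trans (add_le_add ?_ le_rfl)
    refine (norm_sub_le _ _).trans ?_
    refine (add_le_add (norm_sub_le _ _) hδsum).trans ?_
    have h1 := norm_add_le ((4 * γ / 3) • e 1)
      (∑ t ∈ Finset.Icc 2 T, ((2 * (t : ℝ) + 1) * γ / 3) • e t)
    rw [norm_smul, Real.norm_of_nonneg (by positivity : 0 ≤ 4 * γ / 3)] at h1
    rw [norm_smul ((T + 1) ^ 2 * γ / 3 : ℝ) (e (T + 1)),
      Real.norm_of_nonneg (by positivity : 0 ≤ ((T : ℝ) + 1) ^ 2 * γ / 3)]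
    have h2 : 0 ≤ γ * ‖e 1‖ := by positivity
    have h3 : 0 ≤ L * ‖e 1‖ := by positivity
    rw [hc]
    linarith
  have hR2 : R ^ 2 ≤ (T * (T + 3) / 2) * ∑ t ∈ Finset.Icc 2 T, (t : ℝ) * ‖e t‖ ^ 2 := by
    have h1 : R ^ 2 ≤ (∑ t ∈ Finset.Icc 2 T, (t : ℝ))
        * ∑ t ∈ Finset.Icc 2 T, (t : ℝ) * ‖e t‖ ^ 2 :=
      Finset.sum_sq_le_sum_mul_sum_of_sq_le_mul _ (fun t _ => by positivity)
        (fun t _ => by positivity) fun t _ => le_of_eq (by ring)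
    refine h1.trans (mul_le_mul_of_nonneg_right ?_ (Finset.sum_nonneg fun t _ => by positivity))
    clear * - hT
    induction T, hT using Nat.le_induction with
    | base => norm_num
    | succ T hT ih =>
      rw [Finset.sum_Icc_succ_top (by omega)]
      push_cast
      nlinarith
  have hsq : (σ * ‖S‖) ^ 2
      ≤ (2 * c * ‖e 1‖ + c * R + (T + 1) ^ 2 * γ / 3 * ‖e (T + 1)‖ + ‖N‖) ^ 2 := by
    gcongr
  have h4 : ∀ w x y z : ℝ, (w + x + y + z) ^ 2 ≤ 4 * (w ^ 2 + x ^ 2 + y ^ 2 + z ^ 2) :=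
    fun w x y z => by
      nlinarith [sq_nonneg (w - x), sq_nonneg (w - y), sq_nonneg (w - z), sq_nonneg (x - y),
        sq_nonneg (x - z), sq_nonneg (y - z)]
  have h5 := hsq.trans (h4 _ _ _ _)
  have h6 := mul_le_mul_of_nonneg_left hR2 (sq_nonneg c)
  calc σ ^ 2 * ‖S‖ ^ 2 = (σ * ‖S‖) ^ 2 := by ring
    _ ≤ _ := h5
    _ = 4 * (4 * c ^ 2 * ‖e 1‖ ^ 2 + c ^ 2 * R ^ 2
        + ((T + 1) ^ 2 * γ / 3) ^ 2 * ‖e (T + 1)‖ ^ 2 + ‖N‖ ^ 2) := by ring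
    _ ≤ _ := by
      rw [mul_assoc (c ^ 2) (T * (T + 3) / 2 : ℝ)]
      gcongr

/-- W = T(T+3)/2 is the total averaging weight. From T² ≤ 2W and (T+1)² ≤ 2W the noise contributes
O(V/T) after division by W²; the largeness of σ reduces the coefficient of U₁ to 1/4. -/
theorem spg_total_le {γ σ L V U₁ A B : ℝ} (hγ : 0 < γ) (hL : 0 < L) (hV : 0 ≤ V) (hU₁ : 0 ≤ U₁)
    (hσ : 0 < σ) (hσ₁ : 3 * (γ + 2 * L) ^ 2 ≤ γ * σ)
    (hσ₂ : 16 * ((γ + 2 * L) ^ 2 + 3 / 2 * (2 * (γ / 3) + L) ^ 2) ≤ σ ^ 2) {T : ℕ} (hT : 1 ≤ T)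
    (hA : σ * (γ / 3) * A ≤ (2 * (γ / 3) + L) ^ 2 * U₁ + T * V)
    (hB : ((T + 1) * γ / 3) ^ 2 * B ≤ (2 * (γ / 3) + L) ^ 2 * U₁ + T * V) :
    (σ ^ 2)⁻¹ * ((T * (T + 3) / 2 : ℝ)⁻¹ ^ 2 * (4 * (4 * (γ + 2 * L) ^ 2 * U₁
        + (γ + 2 * L) ^ 2 * (T * (T + 3) / 2) * A
        + ((T + 1) ^ 2 * γ / 3) ^ 2 * B + T * (T + 1) ^ 2 * V)))
      ≤ 4⁻¹ * U₁ + 40 * V / (σ ^ 2 * T) := by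
  have hT1 : (1 : ℝ) ≤ T := by exact_mod_cast hT
  set W : ℝ := T * (T + 3) / 2 with hW
  have hW0 : 0 < W := by positivity
  have hW2 : 2 ≤ W := by rw [hW]; nlinarith
  have hTW : ((T : ℝ) + 1) ^ 2 ≤ 2 * W := by rw [hW]; nlinarith
  have hTW' : (T : ℝ) * T ≤ 2 * W := by rw [hW]; nlinarith
  set c := γ + 2 * L
  set q := (2 * (γ / 3) + L) ^ 2 with hq
  have hq0 : 0 ≤ q := sq_nonneg _
  have hQ0 : 0 ≤ q * U₁ + T * V := by positivity
  have hA' : c ^ 2 * A ≤ q * U₁ + T * V := by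
    rcases le_total A 0 with h0 | h0
    · nlinarith [mul_nonneg (sq_nonneg c) (neg_nonneg.2 h0)]
    · refine le_trans ?_ hA
      gcongr
      linarith
  have hB' : ((T + 1) ^ 2 * γ / 3) ^ 2 * B ≤ 2 * W * (q * U₁ + T * V) := by
    calc ((T + 1) ^ 2 * γ / 3) ^ 2 * B = (T + 1) ^ 2 * (((T + 1) * γ / 3) ^ 2 * B) := by ring
      _ ≤ (T + 1) ^ 2 * (q * U₁ + T * V) := by gcongr
      _ ≤ _ := by gcongr
  have h1 : 4 * (4 * c ^ 2 * U₁ + c ^ 2 * W * A + ((T + 1) ^ 2 * γ / 3) ^ 2 * B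
      + T * (T + 1) ^ 2 * V) ≤ 4 * (4 * c ^ 2 * U₁ + 3 * W * (q * U₁ + T * V) + 2 * W * (T * V)) := by
    have h2 := mul_le_mul_of_nonneg_left hA' hW0.le
    have h3 : (T : ℝ) * (T + 1) ^ 2 * V ≤ 2 * W * (T * V) := by
      calc (T : ℝ) * (T + 1) ^ 2 * V = (T + 1) ^ 2 * (T * V) := by ring
        _ ≤ _ := by gcongr
    linarith
  have h2 : W⁻¹ ^ 2 * (4 * (4 * c ^ 2 * U₁ + 3 * W * (q * U₁ + T * V) + 2 * W * (T * V)))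
      ≤ 4 * (c ^ 2 + 3 / 2 * q) * U₁ + 40 * V / T := by
    have e1 : W⁻¹ ^ 2 * (4 * (4 * c ^ 2 * U₁ + 3 * W * (q * U₁ + T * V) + 2 * W * (T * V)))
        = 16 * c ^ 2 * U₁ * W⁻¹ ^ 2 + 12 * q * U₁ * W⁻¹ + 20 * V * (T * W⁻¹) := by
      field_simp
      ring
    have e2 : W⁻¹ ≤ 1 / 2 := by
      rw [inv_le_comm₀ hW0 (by norm_num)]; linarith
    have e3 : W⁻¹ ^ 2 ≤ 1 / 4 := by
      calc W⁻¹ ^ 2 ≤ (1 / 2) ^ 2 := by gcongr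
        _ = _ := by norm_num
    have e4 : T * W⁻¹ ≤ 2 / (T : ℝ) := by
      rw [← div_eq_mul_inv, div_le_div_iff₀ hW0 (by positivity)]
      exact hTW'
    rw [e1]
    calc 16 * c ^ 2 * U₁ * W⁻¹ ^ 2 + 12 * q * U₁ * W⁻¹ + 20 * V * (T * W⁻¹)
        ≤ 16 * c ^ 2 * U₁ * (1 / 4) + 12 * q * U₁ * (1 / 2) + 20 * V * (2 / T) := by gcongr
      _ = _ := by ring
  calc _ ≤ (σ ^ 2)⁻¹ * (4 * (c ^ 2 + 3 / 2 * q) * U₁ + 40 * V / T) := by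
        gcongr
        exact (mul_le_mul_of_nonneg_left h1 (by positivity)).trans h2
    _ = (4⁻¹ * (16 * (c ^ 2 + 3 / 2 * q)) * (σ ^ 2)⁻¹) * U₁ + 40 * V / (σ ^ 2 * T) := by
        field_simp
        ring
    _ ≤ (4⁻¹ * σ ^ 2 * (σ ^ 2)⁻¹) * U₁ + 40 * V / (σ ^ 2 * T) := by gcongr
    _ = _ := by field_simp

theorem spg_stage {d : ℕ} {Ω : Type*} {m : ℕ → MeasurableSpace Ω} {mΩ : MeasurableSpace Ω}
    {P : Measure Ω} (hm : ∀ t, m t ≤ mΩ) (hmono : ∀ t, m t ≤ m (t + 1))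
    {e δ n : ℕ → Ω → Vec d} {γ σ L V U₁ : ℝ} (hγ : 0 < γ) (hL : 0 < L) (hV : 0 ≤ V)
    (hσ₀ : 2 * (γ / 3 + L) ≤ σ) (hσ₁ : 3 * (γ + 2 * L) ^ 2 ≤ γ * σ)
    (hσ₂ : 16 * ((γ + 2 * L) ^ 2 + 3 / 2 * (2 * (γ / 3) + L) ^ 2) ≤ σ ^ 2)
    (he : ∀ t, 1 ≤ t → Measurable[m t] (e t)) (hδm : ∀ t, 1 ≤ t → Measurable[m t] (δ t))
    (hnm : ∀ t, 1 ≤ t → Measurable[m (t + 1)] (n t)) (hδ : ∀ t ω, ‖δ t ω‖ ≤ L * ‖e t ω‖)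
    (hrec : ∀ t : ℕ, 1 ≤ t → ∀ ω, (γ / 3 * (t + 1) + σ) • e (t + 1) ω
      = (γ / 3 * (t + 1)) • e t ω - δ t ω - n t ω)
    (hnoise : ∀ t, 1 ≤ t → ∀ (Y : Ω → Vec d) (c a : ℝ), Measurable[m t] Y →
      ExpLE P (fun ω => ‖Y ω‖ ^ 2) a → ExpLE P (fun ω => ‖Y ω + c • n t ω‖ ^ 2) (a + c ^ 2 * V))
    (hU₁ : ExpLE P (fun ω => ‖e 1 ω‖ ^ 2) U₁) {T : ℕ} (hT : 1 ≤ T) :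
    ExpLE P (fun ω => ‖(T * (T + 3) / 2 : ℝ)⁻¹ • ∑ t ∈ Finset.Icc 2 (T + 1), (t : ℝ) • e t ω‖ ^ 2)
      (4⁻¹ * U₁ + 40 * V / (σ ^ 2 * T)) := by
  have hσ : 0 < σ := lt_of_lt_of_le (by positivity) hσ₀
  -- Deterministic majorants of E‖e t‖², defined by equality so that the potential estimate is a
  -- statement on real sequences.
  obtain ⟨U, hU1, hUrec⟩ : ∃ U : ℕ → ℝ, U 1 = U₁ ∧ ∀ t : ℕ, 1 ≤ t →
      U (t + 1) = ((γ / 3 * (t + 1) + σ) ^ 2)⁻¹ * ((γ / 3 * (t + 1) + L) ^ 2 * U t + V) :=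
    ⟨iterFromOne (fun t u => ((γ / 3 * (t + 1) + σ) ^ 2)⁻¹ * ((γ / 3 * (t + 1) + L) ^ 2 * u + V))
      U₁, rfl, fun t ht => by rw [iterFromOne, if_neg (by omega)]⟩
  have heU : ∀ t, 1 ≤ t → ExpLE P (fun ω => ‖e t ω‖ ^ 2) (U t) := fun t ht => by
    induction t, ht using Nat.le_induction with
    | base => rw [hU1]; exact hU₁
    | succ t ht ih =>
      have hβ : 0 < γ / 3 * ((t : ℝ) + 1) := by positivity
      set β := γ / 3 * ((t : ℝ) + 1) with hβdef
      have hYm : Measurable[m t] fun ω => β • e t ω - δ t ω :=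
        ((he t ht).fun_const_smul β).sub (hδm t ht)
      have hY : ExpLE P (fun ω => ‖β • e t ω - δ t ω‖ ^ 2) ((β + L) ^ 2 * U t) := by
        refine (ih.const_mul (sq_nonneg (β + L))).mono ((hYm.mono (hm t) le_rfl).norm.pow_const 2)
          (fun ω => ?_) le_rfl
        rw [← mul_pow]
        gcongr
        refine (norm_sub_le _ _).trans ?_
        rw [norm_smul, Real.norm_of_nonneg hβ.le, add_mul]
        exact add_le_add le_rfl (hδ t ω)
      have h1 := (hnoise t ht _ (-1) _ hYm hY).const_mul
        (inv_nonneg.2 (sq_nonneg (β + σ)))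
      rw [hUrec t ht]
      refine h1.mono (((he (t + 1) (by omega)).mono (hm _) le_rfl).norm.pow_const 2)
        (fun ω => ?_) (le_of_eq (by rw [hβdef]; ring))
      rw [neg_one_smul, ← sub_eq_add_neg, ← hrec t ht ω, norm_smul,
        Real.norm_of_nonneg (by positivity), mul_pow, ← mul_assoc, inv_mul_cancel₀ (by positivity),
        one_mul]
  have hNm : ∀ T, Measurable[m (T + 1)] (fun ω => ∑ t ∈ Finset.Icc 1 T, ((t : ℝ) + 1) • n t ω) ∧
      ExpLE P (fun ω => ‖∑ t ∈ Finset.Icc 1 T, ((t : ℝ) + 1) • n t ω‖ ^ 2)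
        (∑ t ∈ Finset.Icc 1 T, ((t : ℝ) + 1) ^ 2 * V) := fun T => by
    induction T with
    | zero => exact ⟨by simp, by simpa using ExpLE.zero⟩
    | succ T ih =>
      simp only [Finset.sum_Icc_succ_top (show 1 ≤ T + 1 by omega)]
      exact ⟨(ih.1.mono (hmono _) le_rfl).add ((hnm (T + 1) (by omega)).fun_const_smul _),
        hnoise (T + 1) (by omega) _ _ _ ih.1 ih.2⟩
  have hN : ExpLE P (fun ω => ‖∑ t ∈ Finset.Icc 1 T, ((t : ℝ) + 1) • n t ω‖ ^ 2)
      (T * (T + 1) ^ 2 * V) := by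
    refine (hNm T).2.mono (hNm T).2.1 (fun ω => le_rfl) ?_
    calc ∑ t ∈ Finset.Icc 1 T, ((t : ℝ) + 1) ^ 2 * V
        ≤ ∑ t ∈ Finset.Icc 1 T, ((T : ℝ) + 1) ^ 2 * V := Finset.sum_le_sum fun t ht => by
          have : (t : ℝ) ≤ T := by exact_mod_cast (Finset.mem_Icc.1 ht).2
          gcongr
      _ = _ := by rw [Finset.sum_const, Nat.card_Icc, Nat.add_sub_cancel, nsmul_eq_mul]; ring
  have hA : ExpLE P (fun ω => ∑ t ∈ Finset.Icc 2 T, (t : ℝ) * ‖e t ω‖ ^ 2)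
      (∑ t ∈ Finset.Icc 2 T, (t : ℝ) * U t) :=
    ExpLE.sum fun t ht => (heU t (by have := (Finset.mem_Icc.1 ht).1; omega)).const_mul
      (Nat.cast_nonneg t)
  set W : ℝ := T * (T + 3) / 2 with hW
  have hW0 : 0 ≤ W := by positivity
  have htot := (((((hU₁.const_mul (show 0 ≤ 4 * (γ + 2 * L) ^ 2 by positivity)).add
    (hA.const_mul (show 0 ≤ (γ + 2 * L) ^ 2 * W by positivity))).add
    ((heU (T + 1) (by omega)).const_mul (sq_nonneg (((T : ℝ) + 1) ^ 2 * γ / 3)))).add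
    hN).const_mul (show (0 : ℝ) ≤ 4 by norm_num)).const_mul (sq_nonneg W⁻¹)
    |>.const_mul (show 0 ≤ (σ ^ 2)⁻¹ by positivity)
  have hUnn : ∀ t, 1 ≤ t → 0 ≤ U t := fun t ht => (heU t ht).2.1
  -- Index 0 is a filler, and its value is replaced by 0 to make the sequence nonnegative
  -- everywhere.
  have hpot := spg_potential (β₁ := γ / 3) (U := fun t => if t = 0 then 0 else U t) (V := V) rfl
    hγ hL hσ₀ (fun t => by
      rcases Nat.eq_zero_or_pos t with rfl | ht
      · simp
      · simpa [ht.ne'] using hUnn t ht) (fun t ht => by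
      rw [if_neg (by omega), if_neg (by omega), hUrec t ht, ← mul_assoc,
        mul_inv_cancel₀ (by positivity), one_mul]) hT
  rw [if_neg (by omega), if_neg (by omega), hU1] at hpot
  have hsum : ∑ t ∈ Finset.Icc 2 T, γ / 3 * ((t : ℝ) + 1) * (if t = 0 then 0 else U t)
      = ∑ t ∈ Finset.Icc 2 T, γ / 3 * ((t : ℝ) + 1) * U t :=
    Finset.sum_congr rfl fun t ht => by
      rw [if_neg (by have := (Finset.mem_Icc.1 ht).1; omega)]
  rw [hsum] at hpot
  have hUnn' : ∀ t ∈ Finset.Icc 2 T, 0 ≤ U t := fun t ht =>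
    hUnn t (by have := (Finset.mem_Icc.1 ht).1; omega)
  have hsle : γ / 3 * ∑ t ∈ Finset.Icc 2 T, (t : ℝ) * U t
      ≤ ∑ t ∈ Finset.Icc 2 T, γ / 3 * ((t : ℝ) + 1) * U t := by
    rw [Finset.mul_sum]
    refine Finset.sum_le_sum fun t ht => ?_
    rw [← mul_assoc]
    have := hUnn' t ht
    gcongr
    linarith
  have hs0 : 0 ≤ ∑ t ∈ Finset.Icc 2 T, (t : ℝ) * U t := hA.2.1
  have hUT := hUnn (T + 1) (by omega)
  refine htot.mono ?_ (fun ω => ?_) (spg_total_le hγ hL hV hU₁.2.1 hσ hσ₁ hσ₂ hT ?_ ?_)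
  · have hem : ∀ t ∈ Finset.Icc 2 (T + 1), Measurable fun ω => (t : ℝ) • e t ω := fun t ht =>
      ((he t (by have := (Finset.mem_Icc.1 ht).1; omega)).mono (hm t) le_rfl).fun_const_smul _
    exact ((Finset.measurable_fun_sum _ hem).fun_const_smul W⁻¹).norm.pow_const 2
  · have h1 := norm_spg_sum_sq_le hγ hσ hL (fun t => hδ t ω) (fun t ht => hrec t ht ω) hT
    rw [norm_smul, Real.norm_of_nonneg (inv_nonneg.2 hW0), mul_pow]
    calc W⁻¹ ^ 2 * ‖∑ t ∈ Finset.Icc 2 (T + 1), (t : ℝ) • e t ω‖ ^ 2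
        = (σ ^ 2)⁻¹ * (W⁻¹ ^ 2 * (σ ^ 2 * ‖∑ t ∈ Finset.Icc 2 (T + 1), (t : ℝ) • e t ω‖ ^ 2)) := by
          field_simp
      _ ≤ _ := by gcongr
  · have h0 : 0 ≤ (γ / 3 * (T + 1) + σ) ^ 2 * U (T + 1) := by positivity
    calc σ * (γ / 3) * ∑ t ∈ Finset.Icc 2 T, (t : ℝ) * U t
        = σ * (γ / 3 * ∑ t ∈ Finset.Icc 2 T, (t : ℝ) * U t) := by ring
      _ ≤ σ * ∑ t ∈ Finset.Icc 2 T, γ / 3 * ((t : ℝ) + 1) * U t := by gcongr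
      _ ≤ _ := by linarith
  · have h0 : 0 ≤ σ * ∑ t ∈ Finset.Icc 2 T, γ / 3 * ((t : ℝ) + 1) * U t :=
      mul_nonneg hσ.le ((mul_nonneg (by positivity) hs0).trans hsle)
    have h1 : ((T + 1) * γ / 3) ^ 2 * U (T + 1) ≤ (γ / 3 * (T + 1) + σ) ^ 2 * U (T + 1) := by
      gcongr
      linarith
    linarith

/-! ### The stochastic gradients -/

section Noise

variable {d : ℕ} {Ξ Z : Type*} [MeasurableSpace Ξ] [MeasurableSpace Z] {g h : Vec d → ℝ}
  {Q : Measure Ξ} {Q' : Measure Z} [IsProbabilityMeasure Q']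
  {vg : Vec d → Ξ → Vec d} {vh : Vec d → Z → Vec d} {G : ℝ}

theorem enorm_sq_le_lintegral_sub {a : Vec d} {b : Z → Vec d} (hb : Integrable b Q')
    (hmean : ∫ u, b u ∂Q' = 0) : ‖a‖ₑ ^ 2 ≤ ∫⁻ u, ‖a - b u‖ₑ ^ 2 ∂Q' := by
  have h1 : ∫ u, (a - b u) ∂Q' = a := by
    rw [integral_sub (integrable_const a) hb, hmean]; simp
  have hab : AEStronglyMeasurable (fun u => a - b u) Q' := aestronglyMeasurable_const.sub hb.1
  have h2 : ‖a‖ₑ ≤ eLpNorm (fun u => a - b u) 1 Q' := by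
    rw [eLpNorm_one_eq_lintegral_enorm]
    conv_lhs => rw [← h1]
    exact enorm_integral_le_lintegral_enorm _
  have h3 := h2.trans (eLpNorm_le_eLpNorm_of_exponent_le (p := 1) (q := 2) (by norm_num) hab)
  have h4 : eLpNorm (fun u => a - b u) 2 Q' ^ 2 = ∫⁻ u, ‖a - b u‖ₑ ^ 2 ∂Q' := by
    have := eLpNorm_nnreal_pow_eq_lintegral (f := fun u => a - b u) (μ := Q') (p := 2)
      (by norm_num)
    norm_cast at this
    simpa using this
  rw [← h4]
  gcongr

/-- Jensen for fixed ξ: averaging out the independent centered noise of h can only decrease the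
second moment. -/
theorem IsStochasticGradient.variance_left_le (hvg : IsStochasticGradient g Q vg)
    (hvh : IsStochasticGradient h Q' vh) (hG : BoundedVariance g h Q Q' vg vh G) (x : Vec d) :
    ∫⁻ ξ, ‖vg x ξ - gradient g x‖ₑ ^ 2 ∂Q ≤ ENNReal.ofReal (G ^ 2) := by
  refine le_trans ?_ (hG x)
  have hmg : Measurable (vg x) := hvg.measurable.of_uncurry_left
  have hmh : Measurable (vh x) := hvh.measurable.of_uncurry_left
  have hmeas : Measurable fun u : Ξ × Z =>
      ‖(vg x u.1 - vh x u.2) - (gradient g x - gradient h x)‖ₑ ^ 2 :=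
    (((hmg.comp measurable_fst).sub (hmh.comp measurable_snd)).sub_const _).enorm.pow_const 2
  rw [lintegral_prod _ hmeas.aemeasurable]
  refine lintegral_mono fun ξ => ?_
  refine (enorm_sq_le_lintegral_sub (b := fun u => vh x u - gradient h x)
    ((hvh.integrable x).sub (integrable_const _)) ?_).trans (le_of_eq ?_)
  · rw [integral_sub (hvh.integrable x) (integrable_const _), hvh.mean]; simp
  · refine lintegral_congr fun u => ?_
    congr 2
    abel

theorem IsStochasticGradient.variance_right_le [IsProbabilityMeasure Q] (hvg : IsStochasticGradient g Q vg)
    (hvh : IsStochasticGradient h Q' vh) (hG : BoundedVariance g h Q Q' vg vh G) (x : Vec d) :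
    ∫⁻ u, ‖vh x u - gradient h x‖ₑ ^ 2 ∂Q' ≤ ENNReal.ofReal (G ^ 2) := by
  refine hvh.variance_left_le hvg (fun y => ?_) x
  refine le_trans (le_of_eq ?_) (hG y)
  rw [← lintegral_prod_swap]
  refine lintegral_congr fun u => ?_
  simp only [Prod.swap]
  rw [← enorm_neg]
  congr 2
  abel

/-- The centered noise of the stochastic gradient of `g` at `q.1` minus that of `h` at `q.2`. -/
noncomputable def gradNoise (g h : Vec d → ℝ) (vg : Vec d → Ξ → Vec d) (vh : Vec d → Z → Vec d)
    (q : Vec d × Vec d) (u : Ξ × Z) : Vec d :=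
  (vg q.1 u.1 - gradient g q.1) - (vh q.2 u.2 - gradient h q.2)

theorem measurable_gradNoise (hvg : Measurable (Function.uncurry vg))
    (hvh : Measurable (Function.uncurry vh)) :
    Measurable (Function.uncurry (gradNoise g h vg vh)) := by
  have h1 : Measurable fun w : (Vec d × Vec d) × (Ξ × Z) => vg w.1.1 w.2.1 :=
    hvg.comp (measurable_fst.fst.prodMk measurable_snd.fst)
  have h2 : Measurable fun w : (Vec d × Vec d) × (Ξ × Z) => vh w.1.2 w.2.2 :=
    hvh.comp (measurable_fst.snd.prodMk measurable_snd.snd)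
  exact (h1.sub ((measurable_gradient g).comp measurable_fst.fst)).sub
    (h2.sub ((measurable_gradient h).comp measurable_fst.snd))

/-- SPG samples g at y_t but h at x_k, while the variance bound concerns a common point. Hence the
two separate bounds G², recombined by ‖a - b‖² ≤ 2(‖a‖² + ‖b‖²), which costs the factor 4. -/
theorem gradNoise_moments [IsProbabilityMeasure Q] (hvg : IsStochasticGradient g Q vg)
    (hvh : IsStochasticGradient h Q' vh) (hG : BoundedVariance g h Q Q' vg vh G)
    (q : Vec d × Vec d) :
    Integrable (gradNoise g h vg vh q) (Q.prod Q') ∧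
    ∫ u, gradNoise g h vg vh q u ∂(Q.prod Q') = 0 ∧
    ∫⁻ u, ‖gradNoise g h vg vh q u‖ₑ ^ 2 ∂(Q.prod Q') ≤ ENNReal.ofReal (4 * G ^ 2) := by
  have i1 : Integrable (fun ξ => vg q.1 ξ - gradient g q.1) Q :=
    (hvg.integrable q.1).sub (integrable_const _)
  have i2 : Integrable (fun u => vh q.2 u - gradient h q.2) Q' :=
    (hvh.integrable q.2).sub (integrable_const _)
  have j1 : Integrable (fun u : Ξ × Z => vg q.1 u.1 - gradient g q.1) (Q.prod Q') :=
    i1.comp_fst Q'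
  have j2 : Integrable (fun u : Ξ × Z => vh q.2 u.2 - gradient h q.2) (Q.prod Q') :=
    i2.comp_snd Q
  have m1 : ∫ ξ, (vg q.1 ξ - gradient g q.1) ∂Q = 0 := by
    rw [integral_sub (hvg.integrable _) (integrable_const _), hvg.mean]; simp
  have m2 : ∫ u, (vh q.2 u - gradient h q.2) ∂Q' = 0 := by
    rw [integral_sub (hvh.integrable _) (integrable_const _), hvh.mean]; simp
  refine ⟨j1.sub j2, ?_, ?_⟩
  · unfold gradNoise
    rw [integral_sub j1 j2, integral_fun_fst (fun ξ => vg q.1 ξ - gradient g q.1),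
      integral_fun_snd (fun u => vh q.2 u - gradient h q.2), m1, m2]
    simp
  · have hmg : Measurable fun u : Ξ × Z => ‖vg q.1 u.1 - gradient g q.1‖ₑ ^ 2 :=
      ((hvg.measurable.of_uncurry_left.comp measurable_fst).sub_const _).enorm.pow_const 2
    have hmh : Measurable fun u : Ξ × Z => ‖vh q.2 u.2 - gradient h q.2‖ₑ ^ 2 :=
      ((hvh.measurable.of_uncurry_left.comp measurable_snd).sub_const _).enorm.pow_const 2
    have hpt : ∀ a b : Vec d, ‖a - b‖ₑ ^ 2 ≤ 2 * (‖a‖ₑ ^ 2 + ‖b‖ₑ ^ 2) := fun a b => by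
      have h1 : ‖a - b‖ ^ 2 ≤ 2 * (‖a‖ ^ 2 + ‖b‖ ^ 2) := by
        have h2 : ‖a - b‖ ^ 2 ≤ (‖a‖ + ‖b‖) ^ 2 := by gcongr; exact norm_sub_le a b
        nlinarith [sq_nonneg (‖a‖ - ‖b‖)]
      have h2 := ENNReal.ofReal_le_ofReal h1
      rwa [ENNReal.ofReal_mul (by norm_num), ENNReal.ofReal_add (by positivity) (by positivity),
        ENNReal.ofReal_pow (norm_nonneg _), ENNReal.ofReal_pow (norm_nonneg _),
        ENNReal.ofReal_pow (norm_nonneg _), ofReal_norm, ofReal_norm, ofReal_norm,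
        ENNReal.ofReal_ofNat] at h2
    have v1 := hvg.variance_left_le hvh hG q.1
    have v2 := hvg.variance_right_le hvh hG q.2
    have e1 : ∫⁻ u : Ξ × Z, ‖vg q.1 u.1 - gradient g q.1‖ₑ ^ 2 ∂(Q.prod Q')
        = ∫⁻ ξ, ‖vg q.1 ξ - gradient g q.1‖ₑ ^ 2 ∂Q := by
      rw [lintegral_prod _ hmg.aemeasurable]; simp
    have e2 : ∫⁻ u : Ξ × Z, ‖vh q.2 u.2 - gradient h q.2‖ₑ ^ 2 ∂(Q.prod Q')
        = ∫⁻ u, ‖vh q.2 u - gradient h q.2‖ₑ ^ 2 ∂Q' := by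
      rw [lintegral_prod _ hmh.aemeasurable]; simp
    calc ∫⁻ u, ‖gradNoise g h vg vh q u‖ₑ ^ 2 ∂(Q.prod Q')
        ≤ ∫⁻ u : Ξ × Z, 2 * (‖vg q.1 u.1 - gradient g q.1‖ₑ ^ 2
            + ‖vh q.2 u.2 - gradient h q.2‖ₑ ^ 2) ∂(Q.prod Q') :=
          lintegral_mono fun u => hpt _ _
      _ = 2 * (∫⁻ ξ, ‖vg q.1 ξ - gradient g q.1‖ₑ ^ 2 ∂Q
            + ∫⁻ u, ‖vh q.2 u - gradient h q.2‖ₑ ^ 2 ∂Q') := by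
          rw [lintegral_const_mul _ (by exact hmg.add hmh), lintegral_add_left hmg, e1, e2]
      _ ≤ 2 * (ENNReal.ofReal (G ^ 2) + ENNReal.ofReal (G ^ 2)) := by gcongr
      _ = _ := by
          rw [← ENNReal.ofReal_add (by positivity) (by positivity),
            ← ENNReal.ofReal_ofNat, ← ENNReal.ofReal_mul (by norm_num)]
          congr 1
          ring

end Noise

/-! ### The SPG stages -/

section SPGSteps

variable {d : ℕ} {Ξ Z : Type*} {vg : Vec d → Ξ → Vec d} {vh : Vec d → Z → Vec d} {μ γ : ℝ}

theorem spgIter_succ (v : ℕ → Vec d → Vec d) (hγ : 0 < γ) (hσ : 0 < 1 / μ + γ) (x : Vec d)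
    {t : ℕ} (ht : 1 ≤ t) :
    spgIter v (quadReg μ) γ x (t + 1) = (γ / 3 * (t + 1) + (1 / μ + γ))⁻¹ •
      ((γ / 3 * (t + 1)) • spgIter v (quadReg μ) γ x t + γ • x
        - v t (spgIter v (quadReg μ) γ x t)) := by
  have h1 : spgIter v (quadReg μ) γ x (t + 1) = argmin fun y =>
      inner ℝ y (v t (spgIter v (quadReg μ) γ x t)) + quadReg μ y + γ / 2 * ‖y - x‖ ^ 2
        + 1 / (2 * (3 / (γ * ((t : ℝ) + 1)))) * ‖y - spgIter v (quadReg μ) γ x t‖ ^ 2 := by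
    rw [spgIter, iterFromOne, if_neg (by omega)]
  rw [h1]
  generalize spgIter v (quadReg μ) γ x t = w
  refine argmin_proxStep (κ := 0) _ _ x (by positivity) fun y => ?_
  have h2 : 1 / (2 * (3 / (γ * ((t : ℝ) + 1)))) = γ / 3 * (t + 1) / 2 := by
    field_simp
  rw [quadReg, h2, add_zero]

variable {p : Vec d → Vec d} {T : ℕ → ℕ} {x₁ : Vec d}

theorem ssdcSPG_succ {k : ℕ} (hk : 1 ≤ k) (s : ℕ × ℕ → Ξ × Z) :
    ssdcSPG vg vh p μ γ T x₁ s (k + 1)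
      = spg (fun t y => vg y (s (k, t)).1 - (vh (ssdcSPG vg vh p μ γ T x₁ s k) (s (k, t)).2
          + (1 / μ) • p (ssdcSPG vg vh p μ γ T x₁ s k))) (quadReg μ) γ
          (ssdcSPG vg vh p μ γ T x₁ s k) (T k) := by
  rw [ssdcSPG, iterFromOne, if_neg (by omega)]

theorem sum_Icc_two_cast {T : ℕ} (hT : 1 ≤ T) :
    ∑ t ∈ Finset.Icc 2 (T + 1), (t : ℝ) = T * (T + 3) / 2 := by
  induction T, hT using Nat.le_induction with
  | base => norm_num
  | succ T hT ih =>
    rw [Finset.sum_Icc_succ_top (by omega), ih]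
    push_cast
    ring

theorem spg_sub_eq (v : ℕ → Vec d → Vec d) (q : Vec d → ℝ) (x z : Vec d) {T : ℕ} (hT : 1 ≤ T) :
    spg v q γ x T - z = (T * (T + 3) / 2 : ℝ)⁻¹ •
      ∑ t ∈ Finset.Icc 2 (T + 1), (t : ℝ) • (spgIter v q γ x t - z) := by
  have hT0 : (0 : ℝ) < T := by exact_mod_cast hT
  have hW : (T * (T + 3) / 2 : ℝ) ≠ 0 := by positivity
  simp only [smul_sub, Finset.sum_sub_distrib]
  rw [spg, ← Finset.sum_smul, sum_Icc_two_cast hT, smul_smul, inv_mul_cancel₀ hW, one_smul]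

end SPGSteps

section SPG

variable {d : ℕ} {Ξ Z : Type*} [MeasurableSpace Ξ] [MeasurableSpace Z] {g h : Vec d → ℝ}
  {vg : Vec d → Ξ → Vec d} {vh : Vec d → Z → Vec d} {L μ γ : ℝ} {p : Vec d → Vec d} {T : ℕ → ℕ}
  {x₁ : Vec d}

theorem measurable_spgIter (hvg : Measurable (Function.uncurry vg))
    (hvh : Measurable (Function.uncurry vh)) (hγ : 0 < γ) (hσ : 0 < 1 / μ + γ) {Ω : Type*}
    [MeasurableSpace Ω] {x c : Ω → Vec d} (hx : Measurable x) (hc : Measurable c)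
    {s : ℕ → Ω → Ξ × Z} (t : ℕ) (hs : ∀ t' < t, Measurable (s t')) :
    Measurable fun ω => spgIter (fun t y => vg y (s t ω).1 - (vh (x ω) (s t ω).2 + c ω))
      (quadReg μ) γ (x ω) t := by
  induction t with
  | zero => exact hx
  | succ t ih =>
    rcases Nat.eq_zero_or_pos t with rfl | ht
    · exact hx
    have ih := ih fun t' ht' => hs t' (by omega)
    simp only [spgIter_succ _ hγ hσ _ ht]
    have hst := hs t (by omega)
    have h1 := hvg.comp (ih.prodMk hst.fst)
    have h2 := hvh.comp (hx.prodMk hst.snd)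
    exact (((ih.fun_const_smul (γ / 3 * (t + 1))).add (hx.fun_const_smul γ)).sub
      (h1.sub (h2.add hc))).fun_const_smul _

theorem measurable_ssdcSPG (hvg : Measurable (Function.uncurry vg))
    (hvh : Measurable (Function.uncurry vh)) (hγ : 0 < γ) (hσ : 0 < 1 / μ + γ)
    (hp : Measurable p) {Ω : Type*} [MeasurableSpace Ω] {s : ℕ × ℕ → Ω → Ξ × Z} (k : ℕ)
    (hs : ∀ j : ℕ × ℕ, j.1 < k → Measurable (s j)) :
    Measurable fun ω => ssdcSPG vg vh p μ γ T x₁ (fun j => s j ω) k := by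
  induction k with
  | zero => exact measurable_const
  | succ k ih =>
    rcases Nat.eq_zero_or_pos k with rfl | hk
    · exact measurable_const
    have ih := ih fun j hj => hs j (by omega)
    simp only [ssdcSPG_succ hk, spg]
    apply Measurable.fun_const_smul
    apply Finset.measurable_fun_sum
    rintro t -
    exact (measurable_spgIter hvg hvh hγ hσ ih ((hp.comp ih).fun_const_smul (1 / μ))
      (s := fun t => s (k, t)) t fun t' _ => hs (k, t') (by simp)).fun_const_smul _

/-- The `σ`-algebra of the samples used before step `t` of stage `k`. -/
abbrev samplePast {Ω S : Type*} [MeasurableSpace S] (s : ℕ × ℕ → Ω → S) (k t : ℕ) :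
    MeasurableSpace Ω :=
  ⨆ j ∈ {j : ℕ × ℕ | j.1 < k ∨ (j.1 = k ∧ j.2 < t)}, MeasurableSpace.comap (s j) inferInstance

theorem measurable_samplePast {Ω S : Type*} [MeasurableSpace S] (s : ℕ × ℕ → Ω → S) {k t : ℕ}
    {j : ℕ × ℕ} (hj : j.1 < k ∨ (j.1 = k ∧ j.2 < t)) : Measurable[samplePast s k t] (s j) := by
  have h1 : MeasurableSpace.comap (s j) inferInstance ≤ samplePast s k t :=
    le_iSup₂ (f := fun j (_ : j ∈ {j : ℕ × ℕ | j.1 < k ∨ (j.1 = k ∧ j.2 < t)}) =>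
      MeasurableSpace.comap (s j) inferInstance) j hj
  exact measurable_iff_comap_le.2 h1

theorem samplePast_mono {Ω S : Type*} [MeasurableSpace S] (s : ℕ × ℕ → Ω → S) (k t : ℕ) :
    samplePast s k t ≤ samplePast s k (t + 1) :=
  biSup_mono fun j hj => by
    rcases hj with hj | ⟨hj, hj'⟩
    · exact Or.inl hj
    · exact Or.inr ⟨hj, by omega⟩

theorem samplePast_le {Ω S : Type*} [MeasurableSpace S] {mΩ : MeasurableSpace Ω}
    {s : ℕ × ℕ → Ω → S} (hs : ∀ j, Measurable (s j)) (k t : ℕ) : samplePast s k t ≤ mΩ :=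
  iSup₂_le fun j _ => (hs j).comap_le

theorem indep_samplePast {Ω S : Type*} [MeasurableSpace S] {mΩ : MeasurableSpace Ω}
    {P : Measure Ω} {s : ℕ × ℕ → Ω → S} (hs : ∀ j, Measurable (s j)) (hind : iIndepFun s P)
    (k t : ℕ) :
    Indep (samplePast s k t) (MeasurableSpace.comap (s (k, t)) inferInstance) P := by
  have h1 := indep_iSup_of_disjoint (fun j => (hs j).comap_le) hind.iIndep
    (S := {j : ℕ × ℕ | j.1 < k ∨ (j.1 = k ∧ j.2 < t)}) (T := {(k, t)}) (by simp)
  unfold samplePast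
  simpa only [Set.mem_singleton_iff, iSup_iSup_eq_left] using h1

theorem lintegral_spg_stage {Q : Measure Ξ} {Q' : Measure Z} [IsProbabilityMeasure Q]
    [IsProbabilityMeasure Q'] {G : ℝ} (hgL : LSmooth L g) (hL : 0 < L)
    (hvg : IsStochasticGradient g Q vg) (hvh : IsStochasticGradient h Q' vh)
    (hG : BoundedVariance g h Q Q' vg vh G) (hγ : 0 < γ)
    (hσ₀ : 2 * (γ / 3 + L) ≤ 1 / μ + γ) (hσ₁ : 3 * (γ + 2 * L) ^ 2 ≤ γ * (1 / μ + γ))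
    (hσ₂ : 16 * ((γ + 2 * L) ^ 2 + 3 / 2 * (2 * (γ / 3) + L) ^ 2) ≤ (1 / μ + γ) ^ 2)
    (hp : Measurable p) {z : Vec d → Vec d} (hzm : Measurable z) (hz : IsStageMin g h μ γ p z)
    {Ω : Type*} [mΩ : MeasurableSpace Ω] {P : Measure Ω} [IsProbabilityMeasure P]
    {s : ℕ × ℕ → Ω → Ξ × Z} (hs : ∀ j, Measurable (s j)) (hind : iIndepFun s P)
    (hlaw : ∀ j, P.map (s j) = Q.prod Q') {k : ℕ} (hk : 1 ≤ k) (hT : 1 ≤ T k)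
    {X : ℕ → Ω → Vec d} (hX : X = fun k ω => ssdcSPG vg vh p μ γ T x₁ (fun j => s j ω) k) :
    ∫⁻ ω, ‖X (k + 1) ω - z (X k ω)‖ₑ ^ 2 ∂P ≤ 4⁻¹ * ∫⁻ ω, ‖X k ω - z (X k ω)‖ₑ ^ 2 ∂P
      + ENNReal.ofReal (40 * (4 * G ^ 2) / ((1 / μ + γ) ^ 2 * T k)) := by
  have hσ : 0 < 1 / μ + γ := lt_of_lt_of_le (by positivity) hσ₀
  -- If the initial error has infinite second moment the claim is trivial; otherwise it is a real
  -- `U₁`.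
  rcases eq_or_ne (∫⁻ ω, ‖X k ω - z (X k ω)‖ₑ ^ 2 ∂P) ∞ with htop | hfin
  · rw [htop, ENNReal.mul_top (by norm_num), top_add]
    exact le_top
  set U₁ := (∫⁻ ω, ‖X k ω - z (X k ω)‖ₑ ^ 2 ∂P).toReal with hU₁
  have hsq : ∀ v : Vec d, ENNReal.ofReal (‖v‖ ^ 2) = ‖v‖ₑ ^ 2 := fun v => by
    rw [ENNReal.ofReal_pow (norm_nonneg _), ofReal_norm]
  have hxm : ∀ t, Measurable[samplePast s k t] (X k) := fun t => by
    rw [hX]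
    exact @measurable_ssdcSPG d Ξ Z _ _ vg vh μ γ p T x₁ hvg.measurable hvh.measurable hγ hσ hp Ω
      (samplePast s k t) s k fun j hj => measurable_samplePast s (Or.inl hj)
  set y : ℕ → Ω → Vec d := fun t ω => spgIter (fun t y => vg y (s (k, t) ω).1
    - (vh (X k ω) (s (k, t) ω).2 + (1 / μ) • p (X k ω))) (quadReg μ) γ (X k ω) t with hy
  have hym : ∀ t, Measurable[samplePast s k t] (y t) := fun t =>
    @measurable_spgIter d Ξ Z _ _ vg vh μ γ hvg.measurable hvh.measurable hγ hσ Ω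
      (samplePast s k t) (X k) (fun ω => (1 / μ) • p (X k ω)) (hxm t)
      ((hp.comp (hxm t)).fun_const_smul (1 / μ)) (fun t => s (k, t)) t
      fun t' ht' => measurable_samplePast s (Or.inr ⟨rfl, ht'⟩)
  have hzX : ∀ t, Measurable[samplePast s k t] fun ω => z (X k ω) := fun t => hzm.comp (hxm t)
  have hle := samplePast_le hs k
  have hmom := gradNoise_moments hvg hvh hG
  have hmgn := measurable_gradNoise (g := g) (h := h) hvg.measurable hvh.measurable
  have hpair : ∀ t, Measurable[samplePast s k t] fun ω => (y t ω, X k ω) :=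
    fun t => (hym t).prodMk (hxm t)
  have hstart : ExpLE P (fun ω => ‖y 1 ω - z (X k ω)‖ ^ 2) U₁ := by
    have hy1 : y 1 = X k := rfl
    rw [hy1]
    refine ⟨(((hxm 0).mono (hle 0) le_rfl).sub ((hzX 0).mono (hle 0) le_rfl)).norm.pow_const 2,
      ENNReal.toReal_nonneg, ?_⟩
    rw [hU₁, ENNReal.ofReal_toReal hfin]
    simp only [hsq]
    exact le_rfl
  have hrec : ∀ t : ℕ, 1 ≤ t → ∀ ω,
      (γ / 3 * (t + 1) + (1 / μ + γ)) • (y (t + 1) ω - z (X k ω))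
        = (γ / 3 * (t + 1)) • (y t ω - z (X k ω))
          - (gradient g (y t ω) - gradient g (z (X k ω)))
          - gradNoise g h vg vh (y t ω, X k ω) (s (k, t) ω) := fun t ht ω => by
    have h1 := smul_add_sub_proxStep (β := γ / 3 * (t + 1)) (σ := 1 / μ + γ) (γ := γ)
      (y := y (t + 1) ω) (z := z (X k ω)) (x := y t ω) (x₁ := X k ω)
      (v := vg (y t ω) (s (k, t) ω).1 - vh (X k ω) (s (k, t) ω).2 + gradient h (X k ω))
      (c := gradient h (X k ω) + (1 / μ) • p (X k ω)) (w := gradient g (z (X k ω)))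
      (by positivity) ?_ (hz (X k ω))
    · rw [h1, gradNoise]
      abel
    · simp only [hy]
      rw [spgIter_succ _ hγ hσ _ ht]
      congr 2
      abel
  have hmain := spg_stage (m := samplePast s k) (P := P) hle (samplePast_mono s k)
    (e := fun t ω => y t ω - z (X k ω))
    (δ := fun t ω => gradient g (y t ω) - gradient g (z (X k ω)))
    (n := fun t ω => gradNoise g h vg vh (y t ω, X k ω) (s (k, t) ω)) (V := 4 * G ^ 2)
    hγ hL (by positivity) hσ₀ hσ₁ hσ₂ (fun t _ => (hym t).sub (hzX t))
    (fun t _ => ((measurable_gradient g).comp (hym t)).sub ((measurable_gradient g).comp (hzX t)))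
    (fun t _ => hmgn.comp (((hpair t).mono (samplePast_mono s k t) le_rfl).prodMk
      (measurable_samplePast s (Or.inr ⟨rfl, Nat.lt_succ_self t⟩))))
    (fun t ω => hgL.2 _ _) hrec
    (fun t _ Y c a hY ha => ExpLE.norm_add_noise_sq (hle t) (hs (k, t))
      (indep_samplePast hs hind k t) (hlaw (k, t)) (by positivity) hmgn (fun q => (hmom q).1)
      (fun q => (hmom q).2.1) (fun q => (hmom q).2.2) (hpair t) hY c ha)
    hstart hT
  have hXk : ∀ ω, X (k + 1) ω - z (X k ω) = (T k * (T k + 3) / 2 : ℝ)⁻¹ •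
      ∑ t ∈ Finset.Icc 2 (T k + 1), (t : ℝ) • (y t ω - z (X k ω)) := fun ω => by
    have h1 : X (k + 1) ω = spg (fun t y => vg y (s (k, t) ω).1
        - (vh (X k ω) (s (k, t) ω).2 + (1 / μ) • p (X k ω))) (quadReg μ) γ (X k ω) (T k) := by
      rw [hX]
      exact ssdcSPG_succ hk _
    rw [h1]
    exact spg_sub_eq _ _ _ _ hT
  simp only [hXk]
  have h2 := hmain.2.2
  simp only [hsq] at h2
  refine h2.trans (le_of_eq ?_)
  have hU0 : 0 ≤ U₁ := ENNReal.toReal_nonneg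
  rw [ENNReal.ofReal_add (by positivity) (by positivity), ENNReal.ofReal_mul (by norm_num),
    ENNReal.ofReal_inv_of_pos (by norm_num), ENNReal.ofReal_ofNat, hU₁, ENNReal.ofReal_toReal hfin]

end SPG

/-! ### Convergence of SSDC with SPG -/

theorem spgConvergence_of_envBounds {d : ℕ} {Ξ Z : Type u} [MeasurableSpace Ξ]
    [MeasurableSpace Z] {g h : Vec d → ℝ} {r : Vec d → EReal} {L H ν : ℝ} {x₁ : Vec d}
    (hL : 0 < L) (hν : 0 < ν) (hν' : ν ≤ 1)
    (hg : ConvexOn ℝ Set.univ g) (hgL : LSmooth L g)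
    (hh : ConvexOn ℝ Set.univ h) (hhH : HolderGradient H ν h)
    (hr : ProperLsc r) {m : ℕ} (hm : 1 ≤ m) (henv : EnvBounds g h r x₁ m)
    {Q : Measure Ξ} {Q' : Measure Z} [IsProbabilityMeasure Q] [IsProbabilityMeasure Q']
    {vg : Vec d → Ξ → Vec d} {vh : Vec d → Z → Vec d} {G : ℝ}
    (hvg : IsStochasticGradient g Q vg) (hvh : IsStochasticGradient h Q' vh)
    (hG : BoundedVariance g h Q Q' vg vh G)
    {γ α a b e : ℝ} (hγ : 0 < γ) (hα : 1 ≤ α) (ha : 0 < a) (hab : a ≤ b) (he : m + 2 * ν ≤ e) :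
    SPGConvergence g h r Q Q' vg vh L ν γ α x₁ a b m e := by
  -- From 40V/(σ²T_k) with V = 4G² and T_k ≥ 3Lk/γ.
  set B := 40 * (4 * G ^ 2) * γ / (3 * L) with hB
  obtain ⟨C, ε₀, hC, hε₀, hconv⟩ := convergence_of_stages.{u} hL hν hν' hg hgL hh hhH hr hm henv
    hγ hα ha hab he (B := B) (by positivity)
  set R := 16 * ((γ + 2 * L) ^ 2 + 3 / 2 * (2 * (γ / 3) + L) ^ 2) with hR
  have hR0 : 0 ≤ R := by positivity
  -- Sum of the thresholds on σ required by `spg_stage`; the summand 1 gives R ≤ σ ≤ σ².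
  set S := 2 * (γ / 3 + L) + 3 * (γ + 2 * L) ^ 2 / γ + R + 1 with hS
  have hq0 : 0 ≤ 3 * (γ + 2 * L) ^ 2 / γ := by positivity
  have hS0 : 0 < S := by positivity
  refine ⟨C, min ε₀ (min 1 (1 / S)), hC, by positivity, ?_⟩
  intro Ω _ P _ s ε K T p τ hs hind hlaw hε hεle hKa hKb hT hpm hp hτ hindτ
  have hε₁ : ε ≤ ε₀ := hεle.trans (min_le_left _ _)
  have hμ : S ≤ 1 / ε ^ m := pow_small_bound hm hε hS0 (hεle.trans (min_le_right _ _))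
  have hσS : S ≤ 1 / ε ^ m + γ := by linarith
  have hγL : 0 < 2 * (γ / 3 + L) := by positivity
  have hσ₀ : 2 * (γ / 3 + L) ≤ 1 / ε ^ m + γ := by linarith
  have hσ₁ : 3 * (γ + 2 * L) ^ 2 ≤ γ * (1 / ε ^ m + γ) := by
    have h1 : 3 * (γ + 2 * L) ^ 2 / γ ≤ 1 / ε ^ m + γ := by linarith
    rw [div_le_iff₀ hγ] at h1
    linarith
  have hσ₂ : R ≤ (1 / ε ^ m + γ) ^ 2 := by
    have h1 : 1 ≤ 1 / ε ^ m + γ := by linarith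
    have h2 : R ≤ 1 / ε ^ m + γ := by linarith
    nlinarith
  have hσ : 0 < 1 / ε ^ m + γ := by positivity
  obtain ⟨z, hzm, hz⟩ := exists_measurable_isStageMin (μ := ε ^ m) (γ := γ) h hgL hL
    (by linarith) hpm
  refine hconv Ω P (fun k ω => ssdcSPG vg vh p (ε ^ m) γ T x₁ (fun j => s j ω) k) ε K p z τ hε hε₁
    hKa hKb hpm hp hzm hz
    (fun k => measurable_ssdcSPG hvg.measurable hvh.measurable hγ hσ hpm k fun j _ => hs j) rfl
    (fun k hk => Or.inr ?_) hτ (fun k _ => ?_)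
  · have hk0 : (0 : ℝ) < k := by exact_mod_cast hk
    have hTk := hT k hk
    have hTk3 : 3 * L * k / γ ≤ T k := by linarith
    have hq : 0 < 3 * L * k / γ := by positivity
    have hT0 : (0 : ℝ) < T k := by linarith
    refine (lintegral_spg_stage hgL hL hvg hvh hG hγ hσ₀ hσ₁ hσ₂ hpm hzm hz hs hind hlaw hk
      (by exact_mod_cast hT0) rfl).trans ?_
    refine add_le_add le_rfl (ENNReal.ofReal_le_ofReal ?_)
    calc 40 * (4 * G ^ 2) / ((1 / ε ^ m + γ) ^ 2 * T k)
        ≤ 40 * (4 * G ^ 2) / ((1 / ε ^ m + γ) ^ 2 * (3 * L * k / γ)) := by gcongr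
      _ = B / ((1 / ε ^ m + γ) ^ 2 * k) := by
        rw [hB]
        generalize 1 / ε ^ m + γ = σ at hσ
        field_simp
  · have h1 : Measurable fun j : ℕ × ℕ → Ξ × Z => ssdcSPG vg vh p (ε ^ m) γ T x₁ j k :=
      measurable_ssdcSPG hvg.measurable hvh.measurable hγ hσ hpm k fun j _ => measurable_pi_apply j
    exact hindτ.comp measurable_id h1

/-! ### Assembly of the cases -/

theorem mainTheorem12 {d : ℕ} (g h : Vec d → ℝ) (r : Vec d → EReal) (L H ν : ℝ) (x₁ : Vec d)
    (hL : 0 < L) (hν : 0 < ν) (hν' : ν ≤ 1)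
    (hg : ConvexOn ℝ Set.univ g) (hgL : LSmooth L g)
    (hh : ConvexOn ℝ Set.univ h) (hhH : HolderGradient H ν h)
    (hr : ProperLsc r) (hx₁ : BoundedInitialGap g h r x₁) :
    -- parts (a) and (b): the stochastic proximal gradient method
    (∀ (Ξ Z : Type u) [MeasurableSpace Ξ] [MeasurableSpace Z] (Q : Measure Ξ) (Q' : Measure Z)
        [IsProbabilityMeasure Q] [IsProbabilityMeasure Q']
        (vg : Vec d → Ξ → Vec d) (vh : Vec d → Z → Vec d) (G : ℝ),
        IsStochasticGradient g Q vg → IsStochasticGradient h Q' vh →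
        0 < G → BoundedVariance g h Q Q' vg vh G →
        ∀ γ α a b : ℝ, 3 * L ≤ γ → 1 ≤ α → 0 < a → a ≤ b →
          (LipschitzReg r →
            SPGConvergence g h r Q Q' vg vh L ν γ α x₁ a b 1 (2 * (1 + ν))) ∧
          (FiniteReg r →
            SPGConvergence g h r Q Q' vg vh L ν γ α x₁ a b 2 (2 * (2 + ν)))) ∧
    -- part (c): SVRG, for `g` of finite-sum form
    (∀ (n : ℕ) (gs : Fin n → Vec d → ℝ), 0 < n → (∀ j, LSmooth L (gs j)) →
        (∀ x, g x = (1 / (n : ℝ)) * ∑ j, gs j x) →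
        ∀ γ α a b : ℝ, 0 < γ → 1 ≤ α → 0 < a → a ≤ b →
          (LipschitzReg r →
            SVRGConvergence.{u} gs g h r L ν γ α x₁ a b 1 (2 * (1 + ν))) ∧
          (FiniteReg r ∨ LevelBoundedReg g h r →
            SVRGConvergence.{u} gs g h r L ν γ α x₁ a b 2 (2 * (2 + ν)))) := by

  have hm2 : ((2 : ℕ) : ℝ) + 2 * ν ≤ 2 * (2 + ν) := by push_cast; linarith
  have hm1 : ((1 : ℕ) : ℝ) + 2 * ν ≤ 2 * (1 + ν) := by push_cast; linarith
  refine ⟨?_, ?_⟩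
  · intro Ξ Z _ _ Q Q' _ _ vg vh G hvg hvh _ hG γ α a b hγ hα ha hab
    have hγ0 : 0 < γ := by linarith
    exact ⟨fun hlip => spgConvergence_of_envBounds hL hν hν' hg hgL hh hhH hr le_rfl
        (hlip.envBounds hr hx₁) hvg hvh hG hγ0 hα ha hab hm1,
      fun hfin => spgConvergence_of_envBounds hL hν hν' hg hgL hh hhH hr one_le_two
        (envBounds_two_of_le hr hx₁ hfin.1) hvg hvh hG hγ0 hα ha hab hm2⟩
  · intro n gs _ hgs _ γ α a b hγ hα ha hab
    exact ⟨fun hlip => svrgConvergence_of_envBounds hL hν hν' hg hgL hh hhH hr le_rfl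
        (hlip.envBounds hr hx₁) hgs hγ hα ha hab hm1,
      fun hreg => svrgConvergence_of_envBounds hL hν hν' hg hgL hh hhH hr one_le_two
        (envBounds_two_of_le hr hx₁ (hreg.elim (fun hf => hf.1) fun hl => hl.2.2))
        hgs hγ hα ha hab hm2⟩
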